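/- **Distance formula for $\mathrm{SO}(r,r+q)/\mathrm{S}(\mathrm{O}(r)\times \mathrm{O}(r+q))$.** Let $r\ge 1$, $q\ge 0$ be integers and $N=2r+q$. *Set-up.* Let $\eta_t$ be the symmetric $N\times N$ matrix with antidiagonal $r\times r$ blocks (ones on the antidiagonal) in the upper right and lower left corners, the identity $\mathbf 1_q$ as middle block, and zeros elsewhere; let $\eta_b=\mathrm{diag}(\mathbf 1_{r+q},-\mathbf 1_r)$. Let $\Omega$ be the orthogonal $N\times N$ matrix whose rows are, in order, $e_{r+a}^T$ ($1\le a\le q$), $\tfrac1{\sqrt2}(e_i+e_{N+1-i})^T$ ($1\le i\le r$), $\tfrac1{\sqrt2}(e_i-e_{N+1-i})^T$ ($1\le i\le r$), so that $\Omega\,\eta_t\,\Omega^T=\eta_b$. Put $$\mathrm U=\mathrm{SO}(r,r+q)=\{A\in \mathrm{SL}(N,\mathbb R): A^T\eta_tA=\eta_t\},\qquad \mathrm H=\mathrm U\cap \mathrm O(N)\cong \mathrm S(\mathrm O(r+q)\times \mathrm O(r)),$$ and let $\mathcal S\subset \mathrm U$ be the (Iwasawa) subgroup of upper triangular matrices with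 positive diagonal entries, a Lie group in its standard global solvable coordinates. For $u\in\mathcal S$ let $\mathbb L(u)=u$ be the corresponding matrix and let $$\Theta=\mathbb L^{-1}d\mathbb L,\qquad \mathbb V=\tfrac12(\Theta+\Theta^T),\qquad \mathcal M(u)=\mathbb L(u)\mathbb L(u)^T .$$ Let $\mathfrak m(u)$ be the lower right $r\times r$ block of $\Omega\,\mathcal M(u)\,\Omega^T$ (that is, of $\mathcal M$ written in the $\eta_b$ basis). *Claims.* 1. The map $\mathcal S\to \mathrm U/\mathrm H$, $s\mapsto s\mathrm H$, is a homeomorphism. 2. For every $w\in\mathcal S$ the symmetric matrix $\mathfrak m(w)-\mathbf 1_r$ is positive semidefinite. Hence $$\mathrm N^2(w)=\tfrac14\,\mathrm{Tr}\,\mathrm{arccosh}^2\big(\mathfrak m(w)\big)$$ is well defined, the functional calculus being that of symmetric matrices. 3. $ds^2=\tfrac12\mathrm{Tr}(\mathbb V^2)$ is a smooth Riemannian metric on $\mathcal S$. Its geodesic distance $d$ (the infimum of the lengths of $C^1$ paths) has the following properties. (a) It is invariant under the action of $\mathrm U$ on $\mathrm U/\mathrm H\cong\mathcal S$. (b) For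 all $u,v\in\mathcal S$ there are $Q\in\mathfrak{so}(r,r+q)$ (i.e. $Q^T\eta_t+\eta_tQ=0$) and a curve $\gamma:\mathbb R\to\mathcal S$ with $\gamma(0)=u$, $\gamma(1)=v$ and $$\mathcal M(\gamma(t))=\mathcal M(u)\exp(t\,Q^T),\qquad d(\gamma(t),\gamma(t'))=|t-t'|\,d(u,v)\qquad (t,t'\in\mathbb R).$$ (c) For all $u,v,w\in\mathcal S$: $\mathrm N^2(w)\ge 0$, $\mathrm N^2(w)=0$ if and only if $w$ is the identity, and $$d^2(u,v)=\mathrm N^2(u^{-1}\cdot v).$$ 4. In particular $\mathcal S$ is a *normed solvable Lie group*: it is a solvable Lie group and there are a smooth Riemannian metric $g$ on $\mathcal S$ and a function $\mathrm N^2:\mathcal S\to[0,\infty)$, vanishing exactly at the identity, such that $d_g^2(s_1,s_2)=\mathrm N^2(s_1^{-1}\cdot s_2)$ for all $s_1,s_2\in\mathcal S$. -/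

import Mathlib

open Matrix Manifold
open scoped ContDiff ENNReal Bundle

noncomputable section

/-! ### Normed solvable Lie groups -/

section NormedSolvable

variable {E : Type*} [NormedAddCommGroup E] [NormedSpace ℝ E]
  {H : Type*} [TopologicalSpace H] (I : ModelWithCorners ℝ E H)
  {G : Type*} [TopologicalSpace G] [ChartedSpace H G]

/-- Geodesic (Riemannian) distance of a smooth Riemannian metric `g`: the infimum of the lengths of
`C^1` paths, with value `∞` if there is none. -/
def geodesicEDist [IsManifold I ∞ G]
    (g : Bundle.ContMDiffRiemannianMetric I ∞ E (fun x : G => TangentSpace I x)) (x y : G) : ℝ≥0∞ :=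
  letI : Bundle.RiemannianBundle (fun x : G => TangentSpace I x) := ⟨g.toRiemannianMetric⟩
  riemannianEDist I x y

/-- `N2` is a norm function of the Lie group `G`, relative to the Riemannian metric `g`: it is
nonnegative, vanishes exactly at the identity, and `d_g² (s₁, s₂) = N2 (s₁⁻¹ s₂)`. -/
structure IsNormFunction [Group G] [LieGroup I ∞ G]
    (g : Bundle.ContMDiffRiemannianMetric I ∞ E (fun x : G => TangentSpace I x))
    (N2 : G → ℝ) : Prop where
  nonneg : ∀ s, 0 ≤ N2 s
  eq_zero_iff : ∀ s, N2 s = 0 ↔ s = 1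
  edist_sq : ∀ s₁ s₂, geodesicEDist I g s₁ s₂ ^ 2 = ENNReal.ofReal (N2 (s₁⁻¹ * s₂))

variable (G) in
/-- A normed solvable Lie group: a solvable Lie group with a norm function for some Riemannian
metric. -/
def IsNormedSolvableLieGroup [Group G] [LieGroup I ∞ G] : Prop :=
  Group.IsSolvable G ∧
    ∃ (g : Bundle.ContMDiffRiemannianMetric I ∞ E (fun x : G => TangentSpace I x)) (N2 : G → ℝ),
      IsNormFunction I g N2

end NormedSolvable

/-! ### The group `SO(r, r+q)`, its maximal compact subgroup and its Iwasawa solvable subgroup -/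

namespace SOrrq

/-- Index set of the `N = r + q + r` rows and columns of the matrices in the `η_t` basis. The labels
of the last block are listed in reversed order, see `SOrrq.pos`. -/
abbrev Idx (r q : ℕ) : Type := Fin r ⊕ (Fin q ⊕ Fin r)

/-- Position (`0, …, N - 1`) of an index in the `η_t` basis. -/
def pos {r q : ℕ} : Idx r q → ℕ
  | Sum.inl i => i
  | Sum.inr (Sum.inl a) => r + a
  | Sum.inr (Sum.inr i) => r + q + Fin.rev i

/-- The symmetric matrix `η_t`: antidiagonal `r × r` corner blocks (which read as identity blocks
because the last `r` labels are reversed) and the identity as the middle `q × q` block. -/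
def etaT (r q : ℕ) : Matrix (Idx r q) (Idx r q) ℝ :=
  fromBlocks 0 (fromCols 0 1) (fromRows 0 1) (fromBlocks 1 0 0 0)

/-- The diagonal matrix `η_b` with `r + q` entries `+1` followed by `r` entries `-1`. -/
def etaB (r q : ℕ) : Matrix ((Fin q ⊕ Fin r) ⊕ Fin r) ((Fin q ⊕ Fin r) ⊕ Fin r) ℝ :=
  fromBlocks 1 0 0 (-1)

/-- The orthogonal matrix `Ω` of the change from the `η_t` basis to the `η_b` basis. -/
def Omega (r q : ℕ) : Matrix ((Fin q ⊕ Fin r) ⊕ Fin r) (Idx r q) ℝ :=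
  fromBlocks
    (fromRows 0 ((1 / √2 : ℝ) • 1)) (fromBlocks 1 0 0 ((1 / √2 : ℝ) • 1))
    ((1 / √2 : ℝ) • 1) (fromCols 0 (-((1 / √2 : ℝ) • 1)))

theorem Omega_mul_etaT_mul_transpose (r q : ℕ) :
    Omega r q * etaT r q * (Omega r q)ᵀ = etaB r q := by
  have h : (√2 : ℝ)⁻¹ * (√2)⁻¹ = 1 / 2 := by
    rw [← mul_inv, Real.mul_self_sqrt (by norm_num)]; norm_num
  ext ((i | i) | i) ((j | j) | j) <;>
    simp [Omega, etaT, etaB, Matrix.mul_apply, Matrix.one_apply, h] <;> split_ifs <;> norm_num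

theorem Omega_mul_transpose (r q : ℕ) : Omega r q * (Omega r q)ᵀ = 1 := by
  have h : (√2 : ℝ)⁻¹ * (√2)⁻¹ = 1 / 2 := by
    rw [← mul_inv, Real.mul_self_sqrt (by norm_num)]; norm_num
  ext ((i | i) | i) ((j | j) | j) <;>
    simp [Omega, Matrix.mul_apply, Matrix.one_apply, h] <;> split_ifs <;> norm_num

/-- The permutation of the indices given by the permutation matrix `η_t`. -/
def flip {r q : ℕ} : Idx r q → Idx r q
  | Sum.inl i => Sum.inr (Sum.inr i)
  | Sum.inr (Sum.inl a) => Sum.inr (Sum.inl a)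
  | Sum.inr (Sum.inr i) => Sum.inl i

theorem pos_injective {r q : ℕ} : Function.Injective (pos (r := r) (q := q)) := by
  rintro (i | i | i) (j | j | j) h <;> simp only [pos, Fin.val_rev] at h <;>
    first
    | (exfalso; omega)
    | (congr 2; ext; omega)

theorem flip_flip {r q : ℕ} (i : Idx r q) : flip (flip i) = i := by
  rcases i with i | i | i <;> rfl

theorem etaT_apply {r q : ℕ} (i j : Idx r q) : etaT r q i j = if flip i = j then 1 else 0 := by
  rcases i with i | i | i <;> rcases j with j | j | j <;>
    simp [etaT, flip, Matrix.one_apply]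

theorem etaT_mul {r q : ℕ} (A : Matrix (Idx r q) (Idx r q) ℝ) (i j : Idx r q) :
    (etaT r q * A) i j = A (flip i) j := by
  simp [Matrix.mul_apply, etaT_apply]

theorem mul_etaT {r q : ℕ} (A : Matrix (Idx r q) (Idx r q) ℝ) (i j : Idx r q) :
    (A * etaT r q) i j = A i (flip j) := by
  have h : ∀ k, (flip k = j) = (k = flip j) := fun k => propext
    ⟨fun h => by rw [← h, flip_flip], fun h => by rw [h, flip_flip]⟩
  simp [Matrix.mul_apply, etaT_apply, h]

theorem etaT_mul_etaT (r q : ℕ) : etaT r q * etaT r q = 1 := by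
  ext i j
  rw [etaT_mul, etaT_apply, flip_flip, Matrix.one_apply]

/-- The group `U = SO(r, r+q)`: real matrices of determinant one with `Aᵀ η_t A = η_t`. -/
def U (r q : ℕ) : Subgroup (SpecialLinearGroup (Idx r q) ℝ) where
  carrier := {A | A.1ᵀ * etaT r q * A.1 = etaT r q}
  one_mem' := by
    change (1 : Matrix (Idx r q) (Idx r q) ℝ)ᵀ * etaT r q * 1 = etaT r q
    simp
  mul_mem' := by
    intro A B hA hB
    change A.1ᵀ * etaT r q * A.1 = etaT r q at hA
    change B.1ᵀ * etaT r q * B.1 = etaT r q at hB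
    change (A.1 * B.1)ᵀ * etaT r q * (A.1 * B.1) = etaT r q
    calc _ = B.1ᵀ * (A.1ᵀ * etaT r q * A.1) * B.1 := by
            simp only [Matrix.mul_assoc, transpose_mul]
      _ = _ := by rw [hA, hB]
  inv_mem' := by
    intro A hA
    change A.1ᵀ * etaT r q * A.1 = etaT r q at hA
    change (A⁻¹).1ᵀ * etaT r q * (A⁻¹).1 = etaT r q
    have h1 : A.1 * (A⁻¹).1 = 1 := congrArg Subtype.val (mul_inv_cancel A)
    have h2 : (A⁻¹).1ᵀ * A.1ᵀ = 1 := by rw [← transpose_mul, h1, transpose_one]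
    conv_lhs => rw [← hA]
    simp only [Matrix.mul_assoc, h1, Matrix.mul_one]
    rw [← Matrix.mul_assoc, h2, Matrix.one_mul]

/-- The matrix of an element of `U` in the `η_t` basis. -/
def matU {r q : ℕ} (A : U r q) : Matrix (Idx r q) (Idx r q) ℝ := A.1.1

theorem matU_injective {r q : ℕ} : Function.Injective (matU (r := r) (q := q)) :=
  fun _ _ h => Subtype.ext (Subtype.ext h)

theorem matU_one {r q : ℕ} : matU (1 : U r q) = 1 := rfl

theorem matU_mul {r q : ℕ} (A B : U r q) : matU (A * B) = matU A * matU B := rfl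

theorem matU_inv {r q : ℕ} (A : U r q) : matU A⁻¹ = etaT r q * (matU A)ᵀ * etaT r q := by
  have h : (matU A)ᵀ * etaT r q * matU A = etaT r q := A.2
  have h1 : (etaT r q * (matU A)ᵀ * etaT r q) * matU A = 1 := by
    rw [Matrix.mul_assoc, Matrix.mul_assoc, ← Matrix.mul_assoc (matU A)ᵀ, h, etaT_mul_etaT]
  have h2 : matU A * matU A⁻¹ = 1 := by rw [← matU_mul, mul_inv_cancel, matU_one]
  exact (left_inv_eq_right_inv h1 h2).symm

theorem matU_inv_apply {r q : ℕ} (A : U r q) (i j : Idx r q) :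
    matU A⁻¹ i j = matU A (flip j) (flip i) := by
  rw [matU_inv, mul_etaT, etaT_mul, transpose_apply]

/-- The maximal compact subgroup `H` of `U`: its orthogonal matrices. In the `η_b` basis these are
the block diagonal matrices in `S(O(r+q) × O(r))`. -/
def Hc (r q : ℕ) : Subgroup (U r q) where
  carrier := {A | (matU A)ᵀ * matU A = 1}
  one_mem' := by simp [matU_one]
  mul_mem' := by
    intro A B hA hB
    change (matU A)ᵀ * matU A = 1 at hA
    change (matU B)ᵀ * matU B = 1 at hB
    change (matU (A * B))ᵀ * matU (A * B) = 1
    rw [matU_mul, transpose_mul]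
    calc _ = (matU B)ᵀ * ((matU A)ᵀ * matU A) * matU B := by simp only [Matrix.mul_assoc]
      _ = 1 := by rw [hA, Matrix.mul_one, hB]
  inv_mem' := by
    intro A hA
    change (matU A)ᵀ * matU A = 1 at hA
    change (matU A⁻¹)ᵀ * matU A⁻¹ = 1
    have h1 : matU A⁻¹ = (matU A)ᵀ := by
      refine (left_inv_eq_right_inv hA ?_).symm
      rw [← matU_mul, mul_inv_cancel, matU_one]
    rw [h1, transpose_transpose, mul_eq_one_comm, hA]

theorem matU_inv_eq {r q : ℕ} (A : U r q) : matU A⁻¹ = (matU A)⁻¹ := by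
  have h : matU A * matU A⁻¹ = 1 := by rw [← matU_mul, mul_inv_cancel, matU_one]
  exact (Matrix.inv_eq_right_inv h).symm

theorem mul_apply_diag {r q : ℕ} {A B : Matrix (Idx r q) (Idx r q) ℝ} (hA : BlockTriangular A pos)
    (hB : BlockTriangular B pos) (i : Idx r q) : (A * B) i i = A i i * B i i := by
  rw [Matrix.mul_apply]
  refine Finset.sum_eq_single i (fun j _ hj => ?_) (by simp)
  rcases lt_trichotomy (pos i) (pos j) with h | h | h
  · rw [hB h, mul_zero]
  · exact absurd (pos_injective h).symm hj
  · rw [hA h, zero_mul]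

/-- The Iwasawa solvable subgroup `S` of `U`: its elements which are upper triangular with positive
diagonal entries in the `η_t` basis. -/
def S (r q : ℕ) : Subgroup (U r q) where
  carrier := {A | BlockTriangular (matU A) pos ∧ ∀ i, 0 < matU A i i}
  one_mem' := ⟨by rw [matU_one]; exact blockTriangular_one, by simp [matU_one]⟩
  mul_mem' := by
    intro A B hA hB
    refine ⟨by rw [matU_mul]; exact hA.1.mul hB.1, fun i => ?_⟩
    rw [matU_mul, mul_apply_diag hA.1 hB.1]
    exact mul_pos (hA.2 i) (hB.2 i)
  inv_mem' := by
    intro A hA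
    have h : matU A * matU A⁻¹ = 1 := by rw [← matU_mul, mul_inv_cancel, matU_one]
    have hT : BlockTriangular (matU A⁻¹) pos := by
      rw [matU_inv_eq]
      have : Invertible (matU A) := invertibleOfRightInverse _ _ h
      exact blockTriangular_inv_of_blockTriangular hA.1
    refine ⟨hT, fun i => ?_⟩
    have h2 := mul_apply_diag hA.1 hT i
    rw [h, one_apply_eq] at h2
    exact pos_of_mul_pos_right (h2 ▸ one_pos) (hA.2 i).le

/-- The matrix `𝕃(s)` of an element of `S` in the `η_t` basis. -/
def Lmat {r q : ℕ} (s : S r q) : Matrix (Idx r q) (Idx r q) ℝ := matU (s : U r q)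

/-! ### Solvable coordinates and the Lie group structure of `S` -/

/-- Index set of a global system of coordinates on `S`: Cartan entries together with the strictly
upper triangular entries of the first diagonal block, the `r × q` block, and a skew `r × r` block. -/
abbrev Coord (r q : ℕ) : Type :=
  {p : Fin r × Fin r // p.1 ≤ p.2} ⊕ (Fin r × Fin q) ⊕ {p : Fin r × Fin r // p.1 < p.2}

/-- The upper triangular block of the matrix with given coordinates (diagonal entries are
exponentials of coordinates). -/
def coordA {r q : ℕ} (x : Coord r q → ℝ) : Matrix (Fin r) (Fin r) ℝ := fun i j =>
  if h : i ≤ j then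
    if i = j then Real.exp (x (Sum.inl ⟨(i, j), h⟩)) else x (Sum.inl ⟨(i, j), h⟩)
  else 0

/-- The upper middle block of the matrix with given coordinates. -/
def coordB {r q : ℕ} (x : Coord r q → ℝ) : Matrix (Fin r) (Fin q) ℝ := fun i a =>
  x (Sum.inr (Sum.inl (i, a)))

/-- The skew-symmetric matrix entering the upper right block. -/
def coordZ {r q : ℕ} (x : Coord r q → ℝ) : Matrix (Fin r) (Fin r) ℝ := fun i j =>
  if h : i < j then x (Sum.inr (Sum.inr ⟨(i, j), h⟩))
  else if h : j < i then -x (Sum.inr (Sum.inr ⟨(j, i), h⟩)) else 0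

/-- Block upper triangular matrices with middle block `1`. -/
def blk {r q : ℕ} (A : Matrix (Fin r) (Fin r) ℝ) (B : Matrix (Fin r) (Fin q) ℝ)
    (C : Matrix (Fin r) (Fin r) ℝ) (D : Matrix (Fin q) (Fin r) ℝ) (F : Matrix (Fin r) (Fin r) ℝ) :
    Matrix (Idx r q) (Idx r q) ℝ :=
  fromBlocks A (fromCols B C) 0 (fromBlocks 1 D 0 F)

/-- The matrix in `S` with given coordinates. -/
def coordMat {r q : ℕ} (x : Coord r q → ℝ) : Matrix (Idx r q) (Idx r q) ℝ :=
  blk (coordA x) (coordB x)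
    ((coordZ x - (1 / 2 : ℝ) • (coordB x * (coordB x)ᵀ)) * (coordA x)⁻¹ᵀ)
    (-((coordB x)ᵀ * (coordA x)⁻¹ᵀ)) (coordA x)⁻¹ᵀ

/-- The coordinates of a matrix in `S`. -/
def coordOf {r q : ℕ} (M : Matrix (Idx r q) (Idx r q) ℝ) : Coord r q → ℝ
  | Sum.inl ⟨(i, j), _⟩ =>
      if i = j then Real.log (M (Sum.inl i) (Sum.inl i)) else M (Sum.inl i) (Sum.inl j)
  | Sum.inr (Sum.inl (i, a)) => M (Sum.inl i) (Sum.inr (Sum.inl a))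
  | Sum.inr (Sum.inr ⟨(i, j), _⟩) =>
      (∑ k, M (Sum.inl i) (Sum.inr (Sum.inr k)) * M (Sum.inl j) (Sum.inl k)) +
        1 / 2 * ∑ a, M (Sum.inl i) (Sum.inr (Sum.inl a)) * M (Sum.inl j) (Sum.inr (Sum.inl a))

theorem blk_mul_etaT_mul_transpose {r q : ℕ} (A : Matrix (Fin r) (Fin r) ℝ)
    (B : Matrix (Fin r) (Fin q) ℝ) (C : Matrix (Fin r) (Fin r) ℝ) (D : Matrix (Fin q) (Fin r) ℝ)
    (F : Matrix (Fin r) (Fin r) ℝ) :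
    blk A B C D F * etaT r q * (blk A B C D F)ᵀ =
      fromBlocks (C * Aᵀ + (B * Bᵀ + A * Cᵀ)) (fromCols (B + A * Dᵀ) (A * Fᵀ))
        (fromRows (D * Aᵀ + Bᵀ) (F * Aᵀ)) (fromBlocks 1 0 0 0) := by
  ext i j
  rw [Matrix.mul_apply]
  simp only [mul_etaT]
  rcases i with i | i | i <;> rcases j with j | j | j <;>
    simp [blk, flip, Matrix.mul_apply, Matrix.one_apply, add_comm, add_left_comm]

theorem coordA_upper {r q : ℕ} (x : Coord r q → ℝ) : BlockTriangular (coordA x) id := by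
  intro i j h
  simp only [id] at h
  simp [coordA, not_le.mpr h]

theorem coordA_diag {r q : ℕ} (x : Coord r q → ℝ) (i : Fin r) : 0 < coordA x i i := by
  simp [coordA, Real.exp_pos]

theorem coordA_det {r q : ℕ} (x : Coord r q → ℝ) : 0 < (coordA x).det := by
  rw [det_of_isUpperTriangular (coordA_upper x)]
  exact Finset.prod_pos fun i _ => coordA_diag x i

theorem coordA_mul_inv {r q : ℕ} (x : Coord r q → ℝ) : coordA x * (coordA x)⁻¹ = 1 :=
  Matrix.mul_nonsing_inv _ (isUnit_iff_ne_zero.mpr (coordA_det x).ne')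

theorem coordA_inv_upper {r q : ℕ} (x : Coord r q → ℝ) : BlockTriangular (coordA x)⁻¹ id := by
  have : Invertible (coordA x) := invertibleOfRightInverse _ _ (coordA_mul_inv x)
  exact blockTriangular_inv_of_blockTriangular (coordA_upper x)

theorem coordA_inv_diag {r q : ℕ} (x : Coord r q → ℝ) (i : Fin r) : 0 < (coordA x)⁻¹ i i := by
  have h : (coordA x * (coordA x)⁻¹) i i = coordA x i i * (coordA x)⁻¹ i i := by
    rw [Matrix.mul_apply]
    refine Finset.sum_eq_single i (fun j _ hj => ?_) (by simp)
    rcases lt_or_gt_of_ne hj with h | h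
    · rw [coordA_upper x h, zero_mul]
    · rw [coordA_inv_upper x h, mul_zero]
  rw [coordA_mul_inv, one_apply_eq] at h
  exact pos_of_mul_pos_right (h ▸ one_pos) (coordA_diag x i).le

theorem coordZ_transpose {r q : ℕ} (x : Coord r q → ℝ) : (coordZ x)ᵀ = -coordZ x := by
  ext i j
  rcases lt_trichotomy i j with h | rfl | h
  · simp [coordZ, h, not_lt.mpr h.le]
  · simp [coordZ]
  · simp [coordZ, h, not_lt.mpr h.le]

theorem coordMat_det {r q : ℕ} (x : Coord r q → ℝ) : (coordMat x).det = 1 := by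
  rw [coordMat, blk, det_fromBlocks_zero₂₁, det_fromBlocks_zero₂₁, det_one, one_mul,
    det_transpose, ← det_mul, coordA_mul_inv, det_one]

theorem coordMat_mul_etaT_mul_transpose {r q : ℕ} (x : Coord r q → ℝ) :
    coordMat x * etaT r q * (coordMat x)ᵀ = etaT r q := by
  have h1 : coordA x * (coordA x)⁻¹ = 1 := coordA_mul_inv x
  have h2 : (coordA x)⁻¹ᵀ * (coordA x)ᵀ = 1 := by rw [← transpose_mul, h1, transpose_one]
  rw [coordMat, blk_mul_etaT_mul_transpose]
  simp only [transpose_mul, transpose_transpose, transpose_neg, transpose_sub, transpose_smul,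
    Matrix.mul_neg, Matrix.neg_mul, Matrix.mul_assoc, h2, Matrix.mul_one, coordZ_transpose]
  simp only [← Matrix.mul_assoc, h1, Matrix.one_mul]
  ext (i | i | i) (j | j | j) <;> simp [etaT]
  ring

theorem transpose_mul_etaT_mul {r q : ℕ} {M : Matrix (Idx r q) (Idx r q) ℝ}
    (h : M * etaT r q * Mᵀ = etaT r q) : Mᵀ * etaT r q * M = etaT r q := by
  have h1 : (M * etaT r q) * (Mᵀ * etaT r q) = 1 := by
    rw [← Matrix.mul_assoc, h, etaT_mul_etaT]
  have h2 := congrArg (fun N => N * etaT r q) (mul_eq_one_comm.mp h1)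
  simp only [Matrix.mul_assoc, etaT_mul_etaT, Matrix.mul_one, Matrix.one_mul] at h2
  rw [Matrix.mul_assoc, h2]

theorem coordMat_blockTriangular {r q : ℕ} (x : Coord r q → ℝ) :
    BlockTriangular (coordMat x) pos := by
  rintro (i | i | i) (j | j | j) h <;>
    simp only [pos, Fin.val_rev] at h <;> simp only [coordMat, blk, fromBlocks_apply₁₁,
      fromBlocks_apply₂₁, fromBlocks_apply₁₂, fromBlocks_apply₂₂, Matrix.zero_apply,
      fromCols_apply_inl, fromCols_apply_inr]
  · exact coordA_upper x (Fin.lt_def.mpr h)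
  · omega
  · omega
  · exact one_apply_ne (fun h' => by subst h'; omega)
  · omega
  · exact coordA_inv_upper x (show i < j from Fin.lt_def.mpr (by omega))

theorem coordMat_diag {r q : ℕ} (x : Coord r q → ℝ) (i : Idx r q) : 0 < coordMat x i i := by
  rcases i with i | i | i
  · exact coordA_diag x i
  · simp [coordMat, blk]
  · exact coordA_inv_diag x i

/-- The element of `S` with given coordinates. -/
def coordInv {r q : ℕ} (x : Coord r q → ℝ) : S r q :=
  ⟨⟨⟨coordMat x, coordMat_det x⟩,
    transpose_mul_etaT_mul (coordMat_mul_etaT_mul_transpose x)⟩, coordMat_blockTriangular x, coordMat_diag x⟩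

theorem Lmat_coordInv {r q : ℕ} (x : Coord r q → ℝ) : Lmat (coordInv x) = coordMat x := rfl

theorem coordOf_coordMat {r q : ℕ} (x : Coord r q → ℝ) : coordOf (coordMat x) = x := by
  have h2 : (coordA x)⁻¹ᵀ * (coordA x)ᵀ = 1 := by
    rw [← transpose_mul, coordA_mul_inv, transpose_one]
  funext c
  rcases c with ⟨⟨i, j⟩, h⟩ | ⟨i, a⟩ | ⟨⟨i, j⟩, h⟩
  · by_cases hij : i = j
    · subst hij
      simp [coordOf, coordMat, blk, coordA]
    · have : i ≤ j := h
      simp [coordOf, coordMat, blk, coordA, hij, this]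
  · simp [coordOf, coordMat, blk, coordB]
  · have h3 : ((coordZ x - (1 / 2 : ℝ) • (coordB x * (coordB x)ᵀ)) * (coordA x)⁻¹ᵀ *
        (coordA x)ᵀ) i j = (coordZ x - (1 / 2 : ℝ) • (coordB x * (coordB x)ᵀ)) i j := by
      rw [Matrix.mul_assoc, h2, Matrix.mul_one]
    rw [Matrix.mul_apply] at h3
    have h4 : i < j := h
    refine (congrArg (· + _) h3).trans ?_
    simp [coordZ, h4, Matrix.mul_apply, coordB, coordMat, blk]

theorem Lmat_blk {r q : ℕ} (s : S r q) :
    ∃ A B C D F, Lmat s = blk A B C D F ∧ BlockTriangular A id ∧ ∀ i, 0 < A i i := by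
  obtain ⟨hT, hd⟩ := s.2
  have hT : BlockTriangular (Lmat s) pos := hT
  have hd : ∀ i, 0 < Lmat s i i := hd
  refine ⟨(Lmat s).toBlocks₁₁, (Lmat s).toBlocks₁₂.toCols₁, (Lmat s).toBlocks₁₂.toCols₂,
    (Lmat s).toBlocks₂₂.toBlocks₁₂, (Lmat s).toBlocks₂₂.toBlocks₂₂, ?_, ?_, ?_⟩
  · have hinv : ∀ i j, matU (s : U r q)⁻¹ i j = Lmat s (flip j) (flip i) :=
      matU_inv_apply (s : U r q)
    have hs : (s : U r q)⁻¹ ∈ S r q := (S r q).inv_mem s.2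
    have h1 : ∀ a, Lmat s (Sum.inr (Sum.inl a)) (Sum.inr (Sum.inl a)) = 1 := by
      intro a
      have h := mul_apply_diag hT hs.1 (Sum.inr (Sum.inl a))
      have h' : Lmat s * matU (s : U r q)⁻¹ = 1 := by
        rw [Lmat, ← matU_mul, mul_inv_cancel, matU_one]
      rw [h', hinv, one_apply_eq] at h
      simp only [flip] at h
      nlinarith [hd (Sum.inr (Sum.inl a))]
    ext (i | a | i) (j | b | j)
    · rfl
    · rfl
    · rfl
    · exact hT (show (j : ℕ) < r + a by omega)
    · rcases lt_trichotomy (a : ℕ) b with hab | hab | hab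
      · have := hs.1 (show pos (Sum.inr (Sum.inl a)) < pos (Sum.inr (Sum.inl b)) from
          Nat.add_lt_add_left hab r)
        rw [hinv] at this
        simp only [flip] at this
        simp [blk, this, Fin.ext_iff, hab.ne]
      · obtain rfl : a = b := Fin.ext hab
        simp [blk, h1]
      · have := hT (show pos (Sum.inr (Sum.inl b)) < pos (Sum.inr (Sum.inl a)) from
          Nat.add_lt_add_left hab r)
        simp [blk, this, Fin.ext_iff, hab.ne']
    · rfl
    · exact hT (show (j : ℕ) < r + q + Fin.rev i by omega)
    · exact hT (show r + (b : ℕ) < r + q + Fin.rev i by omega)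
    · rfl
  · intro i j hij
    exact hT (show (j : ℕ) < i from hij)
  · exact fun i => hd (Sum.inl i)

theorem coordMat_coordOf {r q : ℕ} (s : S r q) : coordMat (coordOf (Lmat s)) = Lmat s := by
  obtain ⟨A, B, C, D, F, hs, hA, hd⟩ := Lmat_blk s
  have hη : Lmat s * etaT r q * (Lmat s)ᵀ = etaT r q := by
    have h : (Lmat s)ᵀ * etaT r q * Lmat s = etaT r q := (s : U r q).2
    have h' := transpose_mul_etaT_mul (M := (Lmat s)ᵀ) (by rwa [transpose_transpose])
    rwa [transpose_transpose] at h'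
  rw [hs, blk_mul_etaT_mul_transpose, etaT, fromBlocks_inj] at hη
  obtain ⟨e1, e2, -, -⟩ := hη
  obtain ⟨e2, e3⟩ := (fromCols_ext_iff _ _ _ _).mp e2
  have eA : coordA (coordOf (blk A B C D F)) = A := by
    ext i j
    rcases lt_trichotomy i j with h | rfl | h
    · simp [coordA, coordOf, blk, h.le, h.ne]
    · simp [coordA, coordOf, blk, Real.exp_log (hd i)]
    · rw [hA h]; simp [coordA, not_le.mpr h]
  have eB : coordB (coordOf (blk A B C D F)) = B := by
    ext i j
    simp [coordB, coordOf, blk]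
  have hW : ∀ i j, (C * Aᵀ + (1 / 2 : ℝ) • (B * Bᵀ)) i j +
      (C * Aᵀ + (1 / 2 : ℝ) • (B * Bᵀ)) j i = 0 := by
    intro i j
    have h1 := congrFun (congrFun e1 i) j
    have h2 : (A * Cᵀ) i j = (C * Aᵀ) j i := by
      rw [← transpose_apply (C * Aᵀ), transpose_mul, transpose_transpose]
    have h3 : (B * Bᵀ) j i = (B * Bᵀ) i j := by
      rw [← transpose_apply (B * Bᵀ), transpose_mul, transpose_transpose]
    simp only [Matrix.add_apply, Matrix.smul_apply, h2, h3, Matrix.zero_apply, smul_eq_mul] at *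
    linarith
  have eZ : coordZ (coordOf (blk A B C D F)) = C * Aᵀ + (1 / 2 : ℝ) • (B * Bᵀ) := by
    have h0 : ∀ i j (h : i < j), coordOf (blk A B C D F) (Sum.inr (Sum.inr ⟨(i, j), h⟩)) =
        (C * Aᵀ + (1 / 2 : ℝ) • (B * Bᵀ)) i j := by
      intro i j h
      simp [coordOf, blk, Matrix.mul_apply]
    ext i j
    rcases lt_trichotomy i j with h | rfl | h
    · simp only [coordZ, h, dite_true, h0]
    · simp only [coordZ, lt_irrefl, dite_false]
      linarith [hW i i]
    · simp only [coordZ, h, not_lt.mpr h.le, dite_true, dite_false, h0]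
      linarith [hW i j]
  have eF : A⁻¹ᵀ = F := by
    rw [Matrix.inv_eq_right_inv e3, transpose_transpose]
  have e4 : Aᵀ * F = 1 := by
    have := congrArg transpose (mul_eq_one_comm.mp e3)
    simpa using this
  have eD : -(Bᵀ * A⁻¹ᵀ) = D := by
    have h1 : Bᵀ = -(D * Aᵀ) := by
      have := congrArg transpose (eq_neg_of_add_eq_zero_left e2)
      simpa using this
    rw [eF, h1, Matrix.neg_mul, neg_neg, Matrix.mul_assoc, e4, Matrix.mul_one]
  rw [coordMat, hs, eA, eB, eZ, eD, eF, add_sub_cancel_right, Matrix.mul_assoc, e4,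
    Matrix.mul_one]

/-- The coordinates as a bijection from `S` to a vector space. -/
def coordEquiv (r q : ℕ) : S r q ≃ (Coord r q → ℝ) where
  toFun s := coordOf (Lmat s)
  invFun := coordInv
  left_inv s := Subtype.ext (matU_injective (coordMat_coordOf s))
  right_inv := coordOf_coordMat

theorem contDiff_det {V ι : Type*} [NormedAddCommGroup V] [NormedSpace ℝ V] [Fintype ι]
    [DecidableEq ι] {M : V → Matrix ι ι ℝ} (h : ∀ i j, ContDiff ℝ ∞ fun x => M x i j) :
    ContDiff ℝ ∞ fun x => (M x).det := by
  simp only [det_apply']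
  exact ContDiff.sum fun σ _ => contDiff_const.mul (contDiff_prod fun i _ => h _ _)

theorem contDiff_inv_apply {V ι : Type*} [NormedAddCommGroup V] [NormedSpace ℝ V] [Fintype ι]
    [DecidableEq ι] {M : V → Matrix ι ι ℝ} (h : ∀ i j, ContDiff ℝ ∞ fun x => M x i j)
    (hd : ∀ x, (M x).det ≠ 0) (i j : ι) : ContDiff ℝ ∞ fun x => (M x)⁻¹ i j := by
  simp only [Matrix.inv_def, Ring.inverse_eq_inv', Matrix.smul_apply, smul_eq_mul, adjugate_apply]
  refine ((contDiff_det h).inv hd).mul (contDiff_det fun k l => ?_)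
  by_cases hk : k = j
  · simp only [updateRow_apply, hk, if_true]
    exact contDiff_const
  · simp only [updateRow_apply, hk, if_false]
    exact h _ _

theorem contDiff_mul_apply {V ι κ μ : Type*} [NormedAddCommGroup V] [NormedSpace ℝ V] [Fintype κ]
    {M : V → Matrix ι κ ℝ} {N : V → Matrix κ μ ℝ} (hM : ∀ i j, ContDiff ℝ ∞ fun x => M x i j)
    (hN : ∀ i j, ContDiff ℝ ∞ fun x => N x i j) (i : ι) (j : μ) :
    ContDiff ℝ ∞ fun x => (M x * N x) i j := by
  simp only [Matrix.mul_apply]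
  exact ContDiff.sum fun k _ => (hM _ _).mul (hN _ _)

theorem contDiff_coordA {r q : ℕ} (i j : Fin r) :
    ContDiff ℝ ∞ fun x : Coord r q → ℝ => coordA x i j := by
  unfold coordA
  split_ifs
  · exact Real.contDiff_exp.comp (contDiff_apply _ _ _)
  · exact contDiff_apply _ _ _
  · exact contDiff_const

theorem contDiff_coordZ {r q : ℕ} (i j : Fin r) :
    ContDiff ℝ ∞ fun x : Coord r q → ℝ => coordZ x i j := by
  unfold coordZ
  split_ifs
  · exact contDiff_apply _ _ _
  · exact (contDiff_apply _ _ _).neg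
  · exact contDiff_const

theorem contDiff_coordMat {r q : ℕ} (i j : Idx r q) :
    ContDiff ℝ ∞ fun x : Coord r q → ℝ => coordMat x i j := by
  have hB : ∀ i a, ContDiff ℝ ∞ fun x : Coord r q → ℝ => coordB x i a :=
    fun i a => contDiff_apply _ _ _
  have hF : ∀ i j, ContDiff ℝ ∞ fun x : Coord r q → ℝ => (coordA x)⁻¹ᵀ i j :=
    fun i j => contDiff_inv_apply contDiff_coordA (fun x => (coordA_det x).ne') j i
  have hBt : ∀ i j, ContDiff ℝ ∞ fun x : Coord r q → ℝ => (coordB x)ᵀ i j := fun i j => hB j i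
  rcases i with i | i | i <;> rcases j with j | j | j
  · exact contDiff_coordA i j
  · exact hB i j
  · refine contDiff_mul_apply (fun k l => ?_) hF i j
    exact (contDiff_coordZ k l).sub (contDiff_const.mul (contDiff_mul_apply hB hBt k l))
  · exact contDiff_const
  · exact contDiff_const
  · exact (contDiff_mul_apply hBt hF i j).neg
  · exact contDiff_const
  · exact contDiff_const
  · exact hF i j

theorem contDiff_coordOf {V : Type*} [NormedAddCommGroup V] [NormedSpace ℝ V] {r q : ℕ}
    {M : V → Matrix (Idx r q) (Idx r q) ℝ} (h : ∀ i j, ContDiff ℝ ∞ fun x => M x i j)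
    (hd : ∀ x i, 0 < M x i i) : ContDiff ℝ ∞ fun x => coordOf (M x) := by
  rw [contDiff_pi]
  rintro (⟨⟨i, j⟩, hij⟩ | ⟨i, a⟩ | ⟨⟨i, j⟩, hij⟩)
  · by_cases e : i = j
    · simp only [coordOf, e, if_true]
      exact (h _ _).log fun x => (hd x _).ne'
    · simp only [coordOf, e, if_false]
      exact h _ _
  · exact h _ _
  · exact (ContDiff.sum fun k _ => (h _ _).mul (h _ _)).add
      (contDiff_const.mul (ContDiff.sum fun k _ => (h _ _).mul (h _ _)))

theorem continuous_Lmat_apply {r q : ℕ} (i j : Idx r q) :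
    Continuous fun s : S r q => Lmat s i j := by
  have h1 : Continuous fun s : S r q => (s : U r q) := continuous_subtype_val
  have h2 : Continuous fun u : U r q => (u : SpecialLinearGroup (Idx r q) ℝ) :=
    continuous_subtype_val
  have h3 : Continuous fun u : SpecialLinearGroup (Idx r q) ℝ => u.1 := continuous_subtype_val
  exact (continuous_apply j).comp ((continuous_apply i).comp (h3.comp (h2.comp h1)))

theorem Lmat_diag {r q : ℕ} (s : S r q) (i : Idx r q) : 0 < Lmat s i i := s.2.2 i

/-- The coordinates as a homeomorphism; `S` carries the topology of entrywise convergence. -/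
def coordHomeo (r q : ℕ) : S r q ≃ₜ (Coord r q → ℝ) where
  toEquiv := coordEquiv r q
  continuous_toFun := by
    refine continuous_pi fun c => ?_
    rcases c with ⟨⟨i, j⟩, hij⟩ | ⟨i, a⟩ | ⟨⟨i, j⟩, hij⟩
    · by_cases e : i = j
      · simp only [coordEquiv, coordOf, e, if_true]
        exact (continuous_Lmat_apply _ _).log fun s => (Lmat_diag s _).ne'
      · simp only [coordEquiv, coordOf, e, if_false]
        exact continuous_Lmat_apply _ _
    · exact continuous_Lmat_apply _ _
    · exact (continuous_finsetSum _ fun k _ =>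
        (continuous_Lmat_apply _ _).mul (continuous_Lmat_apply _ _)).add
        (continuous_const.mul (continuous_finsetSum _ fun k _ =>
          (continuous_Lmat_apply _ _).mul (continuous_Lmat_apply _ _)))
  continuous_invFun := by
    have h1 : Continuous fun x : Coord r q → ℝ => coordMat x :=
      continuous_matrix fun i j => (contDiff_coordMat i j).continuous
    have h2 : Continuous fun x : Coord r q → ℝ =>
        (⟨coordMat x, coordMat_det x⟩ : SpecialLinearGroup (Idx r q) ℝ) :=
      Continuous.subtype_mk h1 _
    have h3 : Continuous fun x : Coord r q → ℝ => (coordInv x : U r q) :=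
      Continuous.subtype_mk h2 _
    exact Continuous.subtype_mk h3 _

instance (r q : ℕ) : ChartedSpace (Coord r q → ℝ) (S r q) :=
  (coordHomeo r q).isOpenEmbedding.singletonChartedSpace

instance (r q : ℕ) : IsManifold 𝓘(ℝ, Coord r q → ℝ) ∞ (S r q) :=
  (coordHomeo r q).isOpenEmbedding.isManifold_singleton

theorem contMDiff_coordHomeo (r q : ℕ) :
    ContMDiff 𝓘(ℝ, Coord r q → ℝ) 𝓘(ℝ, Coord r q → ℝ) ∞ (coordHomeo r q) :=
  contMDiff_isOpenEmbedding (coordHomeo r q).isOpenEmbedding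

theorem contMDiff_coordInv (r q : ℕ) :
    ContMDiff 𝓘(ℝ, Coord r q → ℝ) 𝓘(ℝ, Coord r q → ℝ) ∞ (coordInv (r := r) (q := q)) := by
  refine ContMDiff.of_comp_isOpenEmbedding (coordHomeo r q).isOpenEmbedding ?_
  have h : (coordHomeo r q) ∘ coordInv = id := funext coordOf_coordMat
  rw [h]
  exact contMDiff_id

/-- The inclusion of `S` into matrices is smooth. -/
theorem contMDiff_Lmat_apply {r q : ℕ} (i j : Idx r q) :
    ContMDiff 𝓘(ℝ, Coord r q → ℝ) 𝓘(ℝ, ℝ) ∞ fun s : S r q => Lmat s i j := by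
  have h : (fun s : S r q => Lmat s i j) =
      (fun x : Coord r q → ℝ => coordMat x i j) ∘ coordHomeo r q := by
    funext s
    exact (congrFun (congrFun (coordMat_coordOf s) i) j).symm
  rw [h]
  exact (contDiff_coordMat i j).contMDiff.comp (contMDiff_coordHomeo r q)

instance (r q : ℕ) : LieGroup 𝓘(ℝ, Coord r q → ℝ) ∞ (S r q) where
  contMDiff_mul := by
    refine ContMDiff.of_comp_isOpenEmbedding (coordHomeo r q).isOpenEmbedding ?_
    have h : ContDiff ℝ ∞ fun p : (Coord r q → ℝ) × (Coord r q → ℝ) =>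
        coordOf (coordMat p.1 * coordMat p.2) := by
      refine contDiff_coordOf (contDiff_mul_apply (fun i j => (contDiff_coordMat i j).comp
        contDiff_fst) (fun i j => (contDiff_coordMat i j).comp contDiff_snd)) fun p i => ?_
      exact Lmat_diag (coordInv p.1 * coordInv p.2) i
    have h2 : ContMDiff (𝓘(ℝ, Coord r q → ℝ).prod 𝓘(ℝ, Coord r q → ℝ))
        𝓘(ℝ, (Coord r q → ℝ) × (Coord r q → ℝ)) ∞
        fun p : S r q × S r q => (coordHomeo r q p.1, coordHomeo r q p.2) :=
      ((contMDiff_coordHomeo r q).comp contMDiff_fst).prodMk_space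
        ((contMDiff_coordHomeo r q).comp contMDiff_snd)
    refine (h.contMDiff.comp h2).congr fun p => ?_
    change coordOf (Lmat p.1 * Lmat p.2) =
      coordOf (coordMat (coordOf (Lmat p.1)) * coordMat (coordOf (Lmat p.2)))
    rw [coordMat_coordOf, coordMat_coordOf]
  contMDiff_inv := by
    refine ContMDiff.of_comp_isOpenEmbedding (coordHomeo r q).isOpenEmbedding ?_
    have h : ContDiff ℝ ∞ fun x : Coord r q → ℝ => coordOf (Lmat (coordInv x)⁻¹) := by
      refine contDiff_coordOf (fun i j => ?_) fun x i => Lmat_diag _ i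
      have e : (fun x : Coord r q → ℝ => Lmat (coordInv x)⁻¹ i j) =
          fun x => coordMat x (flip j) (flip i) :=
        funext fun x => matU_inv_apply (coordInv x : U r q) i j
      rw [e]
      exact contDiff_coordMat (flip j) (flip i)
    refine (h.contMDiff.comp (contMDiff_coordHomeo r q)).congr fun s => ?_
    change coordOf (Lmat s⁻¹) = coordOf (Lmat (coordInv (coordOf (Lmat s)))⁻¹)
    rw [show coordInv (coordOf (Lmat s)) = s from (coordEquiv r q).left_inv s]

/-! ### The invariant metric, the matrix `𝓜`, and the norm function -/

/-- The differential of the inclusion `𝕃` of `S` into matrices. -/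
def dL {r q : ℕ} (s : S r q) (X : TangentSpace 𝓘(ℝ, Coord r q → ℝ) s) :
    Matrix (Idx r q) (Idx r q) ℝ :=
  Matrix.of fun i j =>
    (mfderiv 𝓘(ℝ, Coord r q → ℝ) 𝓘(ℝ, ℝ) (fun s : S r q => Lmat s i j) s X : ℝ)

/-- The left-invariant one-form `Θ = 𝕃⁻¹ d𝕃` of `S`. -/
def theta {r q : ℕ} (s : S r q) (X : TangentSpace 𝓘(ℝ, Coord r q → ℝ) s) :
    Matrix (Idx r q) (Idx r q) ℝ :=
  (Lmat s)⁻¹ * dL s X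

/-- The vielbein `𝕍 = (Θ + Θᵀ) / 2`, the projection of `Θ` to the symmetric matrices. -/
def vielbein {r q : ℕ} (s : S r q) (X : TangentSpace 𝓘(ℝ, Coord r q → ℝ) s) :
    Matrix (Idx r q) (Idx r q) ℝ :=
  (1 / 2 : ℝ) • (theta s X + (theta s X)ᵀ)

/-- The invariant quadratic form `ds² = ½ Tr 𝕍²`, polarized. At the identity coset it is `Tr ξᵀ ξ`
on the symmetric matrices with off-diagonal blocks `ξ` and `ξᵀ` in the `η_b` basis. -/
def metricForm {r q : ℕ} (s : S r q) (X Y : TangentSpace 𝓘(ℝ, Coord r q → ℝ) s) : ℝ :=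
  1 / 2 * (vielbein s X * vielbein s Y).trace

/-- The symmetric matrix `𝓜 = 𝕃 𝕃ᵀ` in the `η_t` basis. -/
def calM {r q : ℕ} (s : S r q) : Matrix (Idx r q) (Idx r q) ℝ := Lmat s * (Lmat s)ᵀ

/-- The lower right `r × r` block `𝔪` of `𝓜` in the `η_b` basis. -/
def mBlock {r q : ℕ} (s : S r q) : Matrix (Fin r) (Fin r) ℝ :=
  (Omega r q * calM s * (Omega r q)ᵀ).toBlocks₂₂

/-- `N² = ¼ Tr arccosh² 𝔪`, by functional calculus of the symmetric matrix `𝔪`. -/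
def N2 {r q : ℕ} (s : S r q) : ℝ :=
  1 / 4 * (cfc (fun x : ℝ => Real.arcosh x ^ 2) (mBlock s)).trace

end SOrrq

end

/-!
All four claims rest on the two classical decompositions of `U`, made explicit for this group, and
on the smooth dependence of the first one on its argument.

*Iwasawa.* For `A ∈ U` the positive definite matrix `A Aᵀ` has a unique Cholesky factorization `T Tᵀ`
with `T` upper triangular and positive on the diagonal. It depends smoothly on `A Aᵀ`
(`exists_contDiff_cholesky`) and `T` again preserves `η_t` (`exists_Lmat_eq`), so `T ∈ S` and
`A ∈ T H`. Hence `S → U / H` is bijective; it is closed since `S` is closed and `H` compact. Moreover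
the action of `U` on `U / H` becomes a smooth action on `S`, given by `𝓜 ↦ A 𝓜 Aᵀ`
(`exists_contMDiff_action`).

*The metric.* The vielbein of a nonzero tangent vector does not vanish, because its `Θ` is upper
triangular and cannot be skew-symmetric; so `½ Tr 𝕍²` is a Riemannian metric (`metric`). It equals
`⅛ Tr (𝓜⁻¹ d𝓜)²` (`metricForm_eq_trace`), which is invariant under `𝓜 ↦ A 𝓜 Aᵀ`, so that `U` acts by
isometries (`geodesicEDist_action`).

*Cartan.* Every `𝓜(w)` is `kᵀ diag (exp 2a, 1, exp (-2a)) k` with `k ∈ H`, and the `cosh (2 aᵢ)` are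
the eigenvalues of `𝔪(w)` (`exists_cartan`). This gives `𝔪(w) ≥ 1` and `N²(w) = ∑ aᵢ²`
(`N2_eq_sum`). By invariance it is enough to know the distance from `1` to the diagonal element
`diag (exp a, 1, exp (-a))`. The one-parameter subgroup through it has length `(∑ aᵢ²)^½`. No path is
shorter: the diagonal of `𝕍` is `d log 𝕃ᵢᵢ`, so the projection of `S` to its diagonal part does not
expand lengths (`sum_mul_log_le_geodesicEDist`). The geodesics are the images under `U` of the
one-parameter subgroups of the diagonal part (`exists_geodesic`).

Solvability follows by counting vanishing upper diagonals along the derived series.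
-/

noncomputable section

namespace SOrrq

/-! ### Smooth Cholesky factorization -/

/-- By induction on the size: a positive definite matrix is the sum of a rank one matrix, which
carries its last row and column, and of the Schur complement of its last diagonal entry. -/
theorem exists_contDiff_cholesky_fin {V : Type*} [NormedAddCommGroup V] [NormedSpace ℝ V] (n : ℕ)
    (M : V → Matrix (Fin n) (Fin n) ℝ) (hM : ∀ i j, ContDiff ℝ ∞ fun x => M x i j)
    (hp : ∀ x, (M x).PosDef) :
    ∃ T : V → Matrix (Fin n) (Fin n) ℝ, (∀ i j, ContDiff ℝ ∞ fun x => T x i j) ∧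
      (∀ x, BlockTriangular (T x) id) ∧ (∀ x i, 0 < T x i i) ∧ ∀ x, T x * (T x)ᵀ = M x := by
  induction n with
  | zero =>
    exact ⟨M, hM, fun x i => i.elim0, fun x i => i.elim0, fun x => by ext i; exact i.elim0⟩
  | succ n ih =>
    have hd : ∀ x, 0 < M x (Fin.last n) (Fin.last n) := fun x => (hp x).diag_pos
    have hs : ∀ x i j, M x i j = M x j i := fun x i j => (hp x).isHermitian.apply j i
    obtain ⟨T, hT, hT1, hT2, hT3⟩ := ih
      (fun x => of fun i j => M x i.castSucc j.castSucc -
        M x i.castSucc (Fin.last n) * M x j.castSucc (Fin.last n) / M x (Fin.last n) (Fin.last n))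
      (fun i j => (hM _ _).sub (((hM _ _).mul (hM _ _)).div (hM _ _) fun x => (hd x).ne'))
      (fun x => by
        -- the Schur complement is `Bᵀ M B`, hence positive definite
        let B : Matrix (Fin (n + 1)) (Fin n) ℝ := of fun i j => Fin.lastCases
          (-(M x j.castSucc (Fin.last n) / M x (Fin.last n) (Fin.last n)))
          (fun i => if i = j then 1 else 0) i
        have hB : Function.Injective B.mulVec := by
          intro v w h
          funext i
          have := congrFun h i.castSucc
          simpa [Matrix.mulVec, dotProduct, B] using this
        have h := (hp x).conjTranspose_mul_mul_same hB
        convert h using 1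
        ext i j
        have := (hd x).ne'
        simp [Matrix.mul_apply, Fin.sum_univ_castSucc, B, hs x (Fin.last n)]
        field_simp
        ring)
    refine ⟨fun x => of fun i j => Fin.lastCases
        (Fin.lastCases (√(M x (Fin.last n) (Fin.last n)))
          (fun i => M x i.castSucc (Fin.last n) / √(M x (Fin.last n) (Fin.last n))) i)
        (fun j => Fin.lastCases 0 (fun i => T x i j) i) j, ?_, ?_, ?_, ?_⟩
    · have hsq : ContDiff ℝ ∞ fun x => √(M x (Fin.last n) (Fin.last n)) :=
        (hM _ _).sqrt fun x => (hd x).ne'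
      intro i j
      cases j using Fin.lastCases <;> cases i using Fin.lastCases
      · simpa using hsq
      · simp only [of_apply, Fin.lastCases_last, Fin.lastCases_castSucc]
        exact (hM _ _).div hsq fun x => (Real.sqrt_pos.mpr (hd x)).ne'
      · simpa using contDiff_const
      · simpa using hT _ _
    · intro x i j h
      cases j using Fin.lastCases with
      | last => exact absurd h (not_lt.mpr (Fin.le_last i))
      | cast j =>
        cases i using Fin.lastCases with
        | last => simp
        | cast i => simpa using hT1 x (show j < i from h)
    · intro x i
      cases i using Fin.lastCases with
      | last => simpa using hd x
      | cast i => simpa using hT2 x i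
    · intro x
      have h1 : √(M x (Fin.last n) (Fin.last n)) * √(M x (Fin.last n) (Fin.last n)) =
        M x (Fin.last n) (Fin.last n) := Real.mul_self_sqrt (hd x).le
      have h2 := (Real.sqrt_pos.mpr (hd x)).ne'
      have h3 := (hd x).ne'
      ext i j
      have key := fun i j => congrFun (congrFun (hT3 x) i) j
      simp only [Matrix.mul_apply, transpose_apply, of_apply] at key
      cases j using Fin.lastCases <;> cases i using Fin.lastCases <;>
        simp only [Matrix.mul_apply, transpose_apply, of_apply, Fin.sum_univ_castSucc,
          Fin.lastCases_last, Fin.lastCases_castSucc, key]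
      · simp [h1]
      · simp; field_simp
      · simp [hs x (Fin.last n)]; field_simp
      · rw [div_mul_div_comm, h1]; ring

/-- A positive definite family which depends smoothly on a parameter has a smooth factorization
`T Tᵀ` with `T` upper triangular (with respect to the positions of the indices). -/
theorem exists_contDiff_cholesky {V : Type*} [NormedAddCommGroup V] [NormedSpace ℝ V] {r q : ℕ}
    (M : V → Matrix (Idx r q) (Idx r q) ℝ) (hM : ∀ i j, ContDiff ℝ ∞ fun x => M x i j)
    (hp : ∀ x, (M x).PosDef) :
    ∃ T : V → Matrix (Idx r q) (Idx r q) ℝ, (∀ i j, ContDiff ℝ ∞ fun x => T x i j) ∧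
      (∀ x, BlockTriangular (T x) pos) ∧ (∀ x i, 0 < T x i i) ∧ ∀ x, T x * (T x)ᵀ = M x := by
  have hlt : ∀ i : Idx r q, pos i < r + q + r := by
    rintro (i | i | i) <;> simp only [pos, Fin.val_rev] <;> omega
  let e : Idx r q ≃ Fin (r + q + r) := Equiv.ofBijective (fun i => ⟨pos i, hlt i⟩) <| by
    rw [Fintype.bijective_iff_injective_and_card]
    refine ⟨fun i j h => pos_injective (Fin.mk.inj_iff.mp h), ?_⟩
    simp only [Fintype.card_sum, Fintype.card_fin]
    omega
  obtain ⟨T, h1, h2, h3, h4⟩ := exists_contDiff_cholesky_fin (r + q + r)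
    (fun x => (M x).submatrix e.symm e.symm) (fun i j => hM _ _)
    (fun x => (hp x).submatrix e.symm.injective)
  refine ⟨fun x => (T x).submatrix e e, fun i j => h1 _ _,
    fun x i j h => h2 x (show e j < e i from h), fun x i => h3 x _, fun x => ?_⟩
  rw [transpose_submatrix, submatrix_mul_equiv, h4, submatrix_submatrix]
  simp

theorem det_pos_of_blockTriangular {r q : ℕ} {A : Matrix (Idx r q) (Idx r q) ℝ}
    (hA : BlockTriangular A pos) (hA' : ∀ i, 0 < A i i) : 0 < A.det := by
  let _ : LinearOrder (Idx r q) := LinearOrder.lift' pos pos_injective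
  rw [det_of_isUpperTriangular (M := A) fun i j h => hA h]
  exact Finset.prod_pos fun i _ => hA' i

theorem inv_blockTriangular_pos {r q : ℕ} {A : Matrix (Idx r q) (Idx r q) ℝ}
    (hA : BlockTriangular A pos) (hA' : ∀ i, 0 < A i i) :
    A * A⁻¹ = 1 ∧ BlockTriangular A⁻¹ pos ∧ ∀ i, 0 < A⁻¹ i i := by
  have h : A * A⁻¹ = 1 :=
    mul_nonsing_inv _ (isUnit_iff_ne_zero.mpr (det_pos_of_blockTriangular hA hA').ne')
  have hT : BlockTriangular A⁻¹ pos := by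
    have : Invertible A := invertibleOfRightInverse _ _ h
    exact blockTriangular_inv_of_blockTriangular hA
  refine ⟨h, hT, fun i => ?_⟩
  have h2 := mul_apply_diag hA hT i
  rw [h, one_apply_eq] at h2
  exact pos_of_mul_pos_right (h2 ▸ one_pos) (hA' i).le

/-- Uniqueness of the Cholesky factor. -/
theorem eq_of_mul_transpose_eq {r q : ℕ} {A B : Matrix (Idx r q) (Idx r q) ℝ}
    (hA : BlockTriangular A pos) (hA' : ∀ i, 0 < A i i) (hB : BlockTriangular B pos)
    (hB' : ∀ i, 0 < B i i) (h : A * Aᵀ = B * Bᵀ) : A = B := by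
  obtain ⟨hB1, hB2, hB3⟩ := inv_blockTriangular_pos hB hB'
  have hB4 : B⁻¹ * B = 1 := mul_eq_one_comm.mp hB1
  -- `C` is upper triangular and orthogonal, hence diagonal
  obtain ⟨C, hCdef⟩ : ∃ C, C = B⁻¹ * A := ⟨_, rfl⟩
  have hC1 : C * Cᵀ = 1 := by
    rw [hCdef, transpose_mul, Matrix.mul_assoc, ← Matrix.mul_assoc A, h, Matrix.mul_assoc,
      ← transpose_mul, hB4, transpose_one, Matrix.mul_one, hB4]
  have hC2 : BlockTriangular C pos := hCdef ▸ hB2.mul hA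
  have hC3 : ∀ i, 0 < C i i := fun i => by
    rw [hCdef, mul_apply_diag hB2 hA]
    exact mul_pos (hB3 i) (hA' i)
  have hC4 : BlockTriangular Cᵀ pos := by
    rw [← Matrix.inv_eq_right_inv hC1]
    exact (inv_blockTriangular_pos hC2 hC3).2.1
  have hC : C = 1 := by
    ext i j
    rcases lt_trichotomy (pos i) (pos j) with hij | hij | hij
    · rw [one_apply_ne (fun e => hij.ne (congrArg pos e))]
      exact hC4 hij
    · obtain rfl := pos_injective hij
      have := mul_apply_diag hC2 hC4 i
      rw [hC1, one_apply_eq, transpose_apply] at this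
      rw [one_apply_eq]
      nlinarith [hC3 i]
    · rw [one_apply_ne (fun e => hij.ne' (congrArg pos e)), hC2 hij]
  rw [← Matrix.one_mul A, ← hB1, Matrix.mul_assoc, ← hCdef, hC, Matrix.mul_one]

theorem Lmat_injective {r q : ℕ} : Function.Injective (Lmat (r := r) (q := q)) :=
  fun _ _ h => Subtype.ext (matU_injective h)

theorem calM_injective {r q : ℕ} : Function.Injective (calM (r := r) (q := q)) :=
  fun s t h => Lmat_injective (eq_of_mul_transpose_eq s.2.1 s.2.2 t.2.1 t.2.2 h)

/-! ### The Iwasawa decomposition -/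

/-- A coarsening of `pos` that does not separate the middle indices. In contrast with `pos`, its
order is reversed by `flip`. -/
def coarsePos {r q : ℕ} : Idx r q → ℕ
  | Sum.inl i => i
  | Sum.inr (Sum.inl _) => r
  | Sum.inr (Sum.inr i) => r + 1 + Fin.rev i

theorem coarsePos_flip {r q : ℕ} (i : Idx r q) : coarsePos (flip i) + coarsePos i = 2 * r := by
  rcases i with i | i | i <;> simp only [flip, coarsePos, Fin.val_rev] <;> have := i.isLt <;> omega

theorem pos_lt_of_coarsePos_lt {r q : ℕ} {i j : Idx r q} (h : coarsePos i < coarsePos j) :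
    pos i < pos j := by
  rcases i with i | i | i <;> rcases j with j | j | j <;>
    simp only [coarsePos, pos, Fin.val_rev] at * <;> have := i.isLt <;> have := j.isLt <;> omega

theorem eq_of_coarsePos_eq {r q : ℕ} {i j : Idx r q} (h : coarsePos i = coarsePos j) :
    i = j ∨ ∃ a b, i = Sum.inr (Sum.inl a) ∧ j = Sum.inr (Sum.inl b) := by
  rcases i with i | i | i <;> rcases j with j | j | j <;>
    simp only [coarsePos, Fin.val_rev] at * <;> have := i.isLt <;> have := j.isLt <;>
    first
    | (exfalso; omega)
    | exact Or.inr ⟨_, _, rfl, rfl⟩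
    | (left; congr 2; ext; omega)

/-- An orthogonal matrix which is positive semidefinite is the identity. -/
theorem eq_one_of_eq_mul_transpose_of_mul_transpose_eq_one {n : Type*} [Fintype n] [DecidableEq n] {K S : Matrix n n ℝ}
    (hS : K = S * Sᵀ) (hK : K * Kᵀ = 1) : K = 1 := by
  have hs : Kᵀ = K := by rw [hS, transpose_mul, transpose_transpose]
  rw [hs] at hK
  have hp : (K + 1).PosDef := by
    have := posSemidef_self_mul_conjTranspose S
    rw [conjTranspose_eq_transpose_of_trivial, ← hS] at this
    exact PosDef.posSemidef_add this PosDef.one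
  have h : (K + 1) * (K - 1) = 0 := by
    rw [add_mul, mul_sub, mul_sub, hK]; simp
  exact sub_eq_zero.mp (hp.isUnit.mul_right_eq_zero.mp h)

/-- The Cholesky factor `T` of a positive definite matrix `M` in the orthogonal group of `η_t`
belongs to that group: `R = η_t T⁻ᵀ η_t` satisfies `R Rᵀ = M` as well, so that `T⁻¹ R` is orthogonal.
It is block triangular with respect to `coarsePos`, hence block diagonal, and it has positive
diagonal blocks. -/
theorem exists_Lmat_eq {r q : ℕ} {T M : Matrix (Idx r q) (Idx r q) ℝ}
    (hT : BlockTriangular T pos) (hT' : ∀ i, 0 < T i i) (hTM : T * Tᵀ = M)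
    (hM : M * etaT r q * M = etaT r q) : ∃ s : S r q, Lmat s = T := by
  obtain ⟨h1, h2, h3⟩ := inv_blockTriangular_pos hT hT'
  have h1' : T⁻¹ * T = 1 := mul_eq_one_comm.mp h1
  obtain ⟨R, hR⟩ : ∃ R, R = etaT r q * T⁻¹ᵀ * etaT r q := ⟨_, rfl⟩
  have hRij : ∀ i j, R i j = T⁻¹ (flip j) (flip i) := fun i j => by
    rw [hR, mul_etaT, etaT_mul, transpose_apply]
  have hη : (etaT r q)ᵀ = etaT r q := by
    ext (i | i | i) (j | j | j) <;> simp [etaT, Matrix.one_apply, eq_comm]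
  have hMi : M * (T⁻¹ᵀ * T⁻¹) = 1 := by
    rw [← hTM, Matrix.mul_assoc, ← Matrix.mul_assoc Tᵀ, ← transpose_mul, h1',
      transpose_one, Matrix.one_mul, h1]
  have hRM : R * Rᵀ = T * Tᵀ := by
    rw [hTM, hR]
    calc _ = etaT r q * T⁻¹ᵀ * (etaT r q * etaT r q) * T⁻¹ * etaT r q := by
          simp only [transpose_mul, transpose_transpose, hη, Matrix.mul_assoc]
      _ = etaT r q * (T⁻¹ᵀ * T⁻¹) * etaT r q := by
          rw [etaT_mul_etaT, Matrix.mul_one, Matrix.mul_assoc (etaT r q) T⁻¹ᵀ]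
      _ = M * etaT r q * (M * (T⁻¹ᵀ * T⁻¹)) * etaT r q := by
          rw [← Matrix.mul_assoc _ M, hM]
      _ = M := by
          rw [hMi, Matrix.mul_one, Matrix.mul_assoc, etaT_mul_etaT, Matrix.mul_one]
  have hT2 : BlockTriangular T⁻¹ coarsePos := fun i j h => h2 (pos_lt_of_coarsePos_lt h)
  have hR2 : BlockTriangular R coarsePos := fun i j h => by
    rw [hRij]
    refine hT2 ?_
    have := coarsePos_flip i
    have := coarsePos_flip j
    omega
  obtain ⟨C, hCdef⟩ : ∃ C, C = T⁻¹ * R := ⟨_, rfl⟩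
  have hC1 : C * Cᵀ = 1 := by
    rw [hCdef, transpose_mul, Matrix.mul_assoc, ← Matrix.mul_assoc R, hRM, Matrix.mul_assoc,
      ← transpose_mul, h1', transpose_one, Matrix.mul_one, h1']
  have hC2 : BlockTriangular C coarsePos := hCdef ▸ hT2.mul hR2
  have hC3 : BlockTriangular Cᵀ coarsePos := by
    rw [← Matrix.inv_eq_right_inv hC1]
    have : Invertible C := invertibleOfRightInverse _ _ hC1
    exact blockTriangular_inv_of_blockTriangular hC2
  have hC4 : ∀ i j, coarsePos i ≠ coarsePos j → C i j = 0 := fun i j h => by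
    rcases lt_or_gt_of_ne h with h | h
    · exact hC3 h
    · exact hC2 h
  have hC5 : ∀ i j, C i j = ∑ k, T⁻¹ i k * T⁻¹ (flip j) (flip k) := fun i j => by
    rw [hCdef, Matrix.mul_apply]
    simp only [hRij]
  have hC6 : ∀ i, (∀ a, i ≠ Sum.inr (Sum.inl a)) → C i i = 1 := by
    intro i hi
    have hsingle : ∀ j, coarsePos i = coarsePos j → j = i := fun j h => by
      rcases eq_of_coarsePos_eq h with h | ⟨a, b, h, -⟩
      · exact h.symm
      · exact absurd h (hi a)
    have hpos : 0 < C i i := by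
      rw [hC5, Finset.sum_eq_single i]
      · exact mul_pos (h3 _) (h3 _)
      · intro j _ hj
        rcases lt_trichotomy (coarsePos i) (coarsePos j) with h | h | h
        · have h5 := coarsePos_flip i
          have h6 := coarsePos_flip j
          rw [hT2 (show coarsePos (flip j) < coarsePos (flip i) by omega), mul_zero]
        · exact absurd (hsingle j h) hj
        · rw [hT2 h, zero_mul]
      · simp
    have h := congrFun (congrFun hC1 i) i
    rw [Matrix.mul_apply, Finset.sum_eq_single i, one_apply_eq, transpose_apply] at h
    · nlinarith
    · intro j _ hj
      rw [hC4 i j fun h => hj (hsingle j h), zero_mul]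
    · simp
  have hmid : of (fun a b => C (Sum.inr (Sum.inl a)) (Sum.inr (Sum.inl b))) =
      (1 : Matrix (Fin q) (Fin q) ℝ) := by
    refine eq_one_of_eq_mul_transpose_of_mul_transpose_eq_one
      (S := of fun a b => T⁻¹ (Sum.inr (Sum.inl a)) (Sum.inr (Sum.inl b))) ?_ ?_
    · ext a b
      have hz : ∀ (a : Fin q) (i : Fin r), T⁻¹ (Sum.inr (Sum.inl a)) (Sum.inl i) = 0 :=
        fun a i => hT2 i.isLt
      simp [hC5, flip, Matrix.mul_apply, hz]
    · ext a b
      have h := congrFun (congrFun hC1 (Sum.inr (Sum.inl a))) (Sum.inr (Sum.inl b))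
      have hz1 : ∀ (a : Fin q) (i : Fin r), C (Sum.inr (Sum.inl a)) (Sum.inl i) = 0 :=
        fun a i => hC2 i.isLt
      have hz2 : ∀ (a : Fin q) (i : Fin r), C (Sum.inr (Sum.inl a)) (Sum.inr (Sum.inr i)) = 0 :=
        fun a i => hC4 _ _ (by simp only [coarsePos]; omega)
      simpa [Matrix.mul_apply, hz1, hz2, Matrix.one_apply] using h
  have hC : C = 1 := by
    ext i j
    by_cases h : coarsePos i = coarsePos j
    · rcases eq_of_coarsePos_eq h with rfl | ⟨a, b, rfl, rfl⟩
      · by_cases hi : ∀ a, i ≠ Sum.inr (Sum.inl a)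
        · rw [hC6 i hi, one_apply_eq]
        · push Not at hi
          obtain ⟨a, rfl⟩ := hi
          have := congrFun (congrFun hmid a) a
          simpa using this
      · have := congrFun (congrFun hmid a) b
        simpa [Matrix.one_apply] using this
    · rw [hC4 i j h, one_apply_ne (fun e => h (congrArg _ e))]
  have hRT : R = T := by
    rw [← Matrix.one_mul R, ← h1, Matrix.mul_assoc, ← hCdef, hC, Matrix.mul_one]
  have hT1 : T * etaT r q * Tᵀ = etaT r q := by
    conv_lhs => rw [← hRT, hR]
    rw [Matrix.mul_assoc (etaT r q * T⁻¹ᵀ), etaT_mul_etaT, Matrix.mul_one, ← hR, hRT,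
      Matrix.mul_assoc, ← transpose_mul, h1, transpose_one, Matrix.mul_one]
  have hdet : T.det = 1 := by
    have h := congrArg det hT1
    rw [det_mul, det_mul, det_transpose] at h
    have h0 : (etaT r q).det ≠ 0 := by
      intro h0
      have := congrArg det (etaT_mul_etaT r q)
      simp [h0] at this
    have := det_pos_of_blockTriangular hT hT'
    have h' : T.det * T.det = 1 := mul_right_cancel₀ h0 (by linarith)
    nlinarith
  exact ⟨⟨⟨⟨T, hdet⟩, transpose_mul_etaT_mul hT1⟩, hT, hT'⟩, rfl⟩

theorem matU_mul_etaT_mul_transpose {r q : ℕ} (A : U r q) :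
    matU A * etaT r q * (matU A)ᵀ = etaT r q := by
  have h := transpose_mul_etaT_mul (M := (matU A)ᵀ) (by rw [transpose_transpose]; exact A.2)
  rwa [transpose_transpose] at h

theorem matU_transpose_mul_etaT_mul {r q : ℕ} (A : U r q) :
    (matU A)ᵀ * etaT r q * matU A = etaT r q := A.2

theorem matU_det {r q : ℕ} (A : U r q) : (matU A).det = 1 := A.1.2

theorem posDef_mul_transpose {r q : ℕ} (A : U r q) : (matU A * (matU A)ᵀ).PosDef := by
  have h : IsUnit (matU A) := by
    rw [isUnit_iff_isUnit_det, matU_det]; exact isUnit_one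
  have := PosDef.mul_conjTranspose_self (matU A) (vecMul_injective_of_isUnit h)
  rwa [conjTranspose_eq_transpose_of_trivial] at this

/-- The Iwasawa decomposition, smoothly in parameters. -/
theorem exists_contDiff_iwasawa {V : Type*} [NormedAddCommGroup V] [NormedSpace ℝ V] {r q : ℕ}
    (A : V → U r q) (hA : ∀ i j, ContDiff ℝ ∞ fun x => matU (A x) i j) :
    ∃ f : V → S r q, (∀ i j, ContDiff ℝ ∞ fun x => Lmat (f x) i j) ∧
      ∀ x, calM (f x) = matU (A x) * (matU (A x))ᵀ := by
  obtain ⟨T, h1, h2, h3, h4⟩ := exists_contDiff_cholesky (fun x => matU (A x) * (matU (A x))ᵀ)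
    (contDiff_mul_apply hA fun i j => hA j i) fun x => posDef_mul_transpose (A x)
  have h5 : ∀ x, ∃ s : S r q, Lmat s = T x := fun x => by
    refine exists_Lmat_eq (h2 x) (h3 x) (h4 x) ?_
    calc _ = matU (A x) * ((matU (A x))ᵀ * etaT r q * matU (A x)) * (matU (A x))ᵀ := by
          simp only [Matrix.mul_assoc]
      _ = _ := by rw [matU_transpose_mul_etaT_mul, matU_mul_etaT_mul_transpose]
  choose f hf using h5
  exact ⟨f, by simpa only [hf] using h1, fun x => by rw [calM, hf, h4]⟩

theorem exists_calM_eq {r q : ℕ} (A : U r q) : ∃ s : S r q, calM s = matU A * (matU A)ᵀ := by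
  obtain ⟨f, -, hf⟩ := exists_contDiff_iwasawa (V := ℝ) (fun _ => A) fun i j => contDiff_const
  exact ⟨f 0, hf 0⟩

/-- Two elements of `U` with the same `A Aᵀ` differ by an element of `H`. -/
theorem mk_eq_mk_iff {r q : ℕ} (A B : U r q) :
    (A : U r q ⧸ Hc r q) = B ↔ matU A * (matU A)ᵀ = matU B * (matU B)ᵀ := by
  rw [QuotientGroup.eq]
  change (matU (A⁻¹ * B))ᵀ * matU (A⁻¹ * B) = 1 ↔ _
  rw [mul_eq_one_comm, matU_mul, transpose_mul]
  have h1 : matU A⁻¹ * matU A = 1 := by rw [← matU_mul, inv_mul_cancel, matU_one]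
  have h2 : matU A * matU A⁻¹ = 1 := by rw [← matU_mul, mul_inv_cancel, matU_one]
  have h3 : (matU A⁻¹)ᵀ * (matU A)ᵀ = 1 := by rw [← transpose_mul, h2, transpose_one]
  have h4 : (matU A)ᵀ * (matU A⁻¹)ᵀ = 1 := by rw [← transpose_mul, h1, transpose_one]
  constructor
  · intro h
    calc _ = matU A * (matU A⁻¹ * matU B * ((matU B)ᵀ * (matU A⁻¹)ᵀ)) * (matU A)ᵀ := by
          rw [h, Matrix.mul_one]
      _ = (matU A * matU A⁻¹) * (matU B * (matU B)ᵀ) * ((matU A⁻¹)ᵀ * (matU A)ᵀ) := by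
          simp only [Matrix.mul_assoc]
      _ = _ := by rw [h2, h3, Matrix.one_mul, Matrix.mul_one]
  · intro h
    calc _ = matU A⁻¹ * (matU B * (matU B)ᵀ) * (matU A⁻¹)ᵀ := by simp only [Matrix.mul_assoc]
      _ = (matU A⁻¹ * matU A) * ((matU A)ᵀ * (matU A⁻¹)ᵀ) := by
          rw [← h]; simp only [Matrix.mul_assoc]
      _ = 1 := by rw [h1, h4, Matrix.one_mul]

/-! ### The Riemannian metric -/

section Metric

variable {r q : ℕ}

/-- As `S` has a single chart, the trivializations of its tangent bundle are identities. -/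
theorem trivializationAt_tangentSpace_symm (s₀ s : S r q) (v : Coord r q → ℝ) :
    (trivializationAt (Coord r q → ℝ) (TangentSpace 𝓘(ℝ, Coord r q → ℝ)) s₀).symm s v = v := by
  have hs : ∀ s₀ s : S r q, s ∈ (chartAt (Coord r q → ℝ) s₀).source := fun s₀ s => by
    rw [show chartAt (Coord r q → ℝ) s₀ = chartAt (Coord r q → ℝ) s from rfl]
    exact mem_chart_source _ s
  have h := TangentBundle.symmL_trivializationAt_eq_core (I := 𝓘(ℝ, Coord r q → ℝ)) (hs s₀ s)
  have h2 := congrFun (congrArg DFunLike.coe h) v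
  rw [Bundle.Trivialization.symmL_apply _ (by
    rw [TangentBundle.trivializationAt_baseSet]; exact hs s₀ s)] at h2
  refine h2.trans ?_
  exact (tangentBundleCore 𝓘(ℝ, Coord r q → ℝ) (S r q)).coordChange_self
    (achart _ s) s (mem_chart_source _ s) v

/-- A family of bilinear forms on the tangent spaces of `S` is smooth if it is smooth in the global
coordinates. -/
theorem contMDiff_bilinear
    {B : (Coord r q → ℝ) → (Coord r q → ℝ) →L[ℝ] (Coord r q → ℝ) →L[ℝ] ℝ} (hB : ContDiff ℝ ∞ B) :
    ContMDiff 𝓘(ℝ, Coord r q → ℝ)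
      (𝓘(ℝ, Coord r q → ℝ).prod 𝓘(ℝ, (Coord r q → ℝ) →L[ℝ] (Coord r q → ℝ) →L[ℝ] ℝ)) ∞
      (fun s : S r q => Bundle.TotalSpace.mk' ((Coord r q → ℝ) →L[ℝ] (Coord r q → ℝ) →L[ℝ] ℝ)
        (E := fun s : S r q => TangentSpace 𝓘(ℝ, Coord r q → ℝ) s →L[ℝ]
          TangentSpace 𝓘(ℝ, Coord r q → ℝ) s →L[ℝ] ℝ) s (B (coordHomeo r q s))) := by
  intro s₀
  rw [contMDiffAt_hom_bundle]
  have hmem : ∀ s₀ s : S r q, s ∈ (trivializationAt (Coord r q → ℝ)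
      (TangentSpace 𝓘(ℝ, Coord r q → ℝ)) s₀).baseSet := fun s₀ s => by
    rw [TangentBundle.trivializationAt_baseSet,
      show chartAt (Coord r q → ℝ) s₀ = chartAt (Coord r q → ℝ) s from rfl]
    exact mem_chart_source _ s
  refine ⟨contMDiffAt_id, ?_⟩
  refine ((hB.contMDiff.comp (contMDiff_coordHomeo r q)) s₀).congr_of_eventuallyEq
    (Filter.Eventually.of_forall fun s => ?_)
  ext v w
  refine (inCoordinates_apply_eq₂ (E₃ := Bundle.Trivial (S r q) ℝ) (hmem s₀ s) (hmem s₀ s)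
    (Set.mem_univ _)).trans ?_
  rw [trivializationAt_tangentSpace_symm, trivializationAt_tangentSpace_symm]
  simp
  rfl

end Metric

theorem chartAt_symm_apply {r q : ℕ} (s : S r q) (x : Coord r q → ℝ) :
    (chartAt (Coord r q → ℝ) s).symm x = coordInv x := by
  refine (coordHomeo r q).injective ?_
  have h := (chartAt (Coord r q → ℝ) s).right_inv (x := x) <| by
    change x ∈ ((coordHomeo r q).isOpenEmbedding.toOpenPartialHomeomorph _).target
    simp
  exact h.trans (coordOf_coordMat x).symm

theorem dL_apply {r q : ℕ} (s : S r q) (i j : Idx r q)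
    (X : TangentSpace 𝓘(ℝ, Coord r q → ℝ) s) :
    dL s X i j = fderiv ℝ (fun x : Coord r q → ℝ => coordMat x i j) (coordHomeo r q s) X := by
  have h : MDifferentiableAt 𝓘(ℝ, Coord r q → ℝ) 𝓘(ℝ, ℝ) (fun s : S r q => Lmat s i j) s :=
    (contMDiff_Lmat_apply i j).mdifferentiable (by simp) s
  have e := congrFun (congrArg DFunLike.coe h.mfderiv) X
  have e2 : writtenInExtChartAt 𝓘(ℝ, Coord r q → ℝ) 𝓘(ℝ, ℝ) s (fun s : S r q => Lmat s i j) =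
      fun x => coordMat x i j := by
    funext x
    change Lmat ((chartAt (Coord r q → ℝ) s).symm x) i j = _
    rw [chartAt_symm_apply]
    rfl
  refine e.trans ?_
  rw [e2]
  simp only [modelWithCornersSelf_coe, Set.range_id, fderivWithin_univ]
  rfl

/-- The entries of the vielbein in coordinates. -/
def vielbeinForm {r q : ℕ} (x : Coord r q → ℝ) (i j : Idx r q) : (Coord r q → ℝ) →L[ℝ] ℝ :=
  (1 / 2 : ℝ) • ((∑ k, (coordMat x)⁻¹ i k • fderiv ℝ (fun y => coordMat y k j) x) +
    ∑ k, (coordMat x)⁻¹ j k • fderiv ℝ (fun y => coordMat y k i) x)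

theorem vielbeinForm_eq {r q : ℕ} (x X : Coord r q → ℝ) (i j : Idx r q) :
    vielbeinForm x i j X =
      1 / 2 * ((∑ k, (coordMat x)⁻¹ i k * fderiv ℝ (fun y => coordMat y k j) x X) +
        ∑ k, (coordMat x)⁻¹ j k * fderiv ℝ (fun y => coordMat y k i) x X) := by
  simp only [vielbeinForm, _root_.smul_apply, _root_.add_apply, _root_.sum_apply, smul_eq_mul]

theorem vielbeinForm_apply {r q : ℕ} (s : S r q) (X : TangentSpace 𝓘(ℝ, Coord r q → ℝ) s)
    (i j : Idx r q) : vielbeinForm (coordHomeo r q s) i j X = vielbein s X i j := by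
  have h : coordMat (coordHomeo r q s) = Lmat s := coordMat_coordOf s
  refine (vielbeinForm_eq _ _ i j).trans ?_
  rw [h]
  simp only [vielbein, theta, Matrix.smul_apply, Matrix.add_apply, transpose_apply,
    Matrix.mul_apply, dL_apply, smul_eq_mul]

theorem contDiff_vielbeinForm {r q : ℕ} (i j : Idx r q) :
    ContDiff ℝ ∞ fun x : Coord r q → ℝ => vielbeinForm x i j := by
  have h1 : ∀ i j, ContDiff ℝ ∞ fun x : Coord r q → ℝ => (coordMat x)⁻¹ i j :=
    contDiff_inv_apply contDiff_coordMat fun x => by rw [coordMat_det]; exact one_ne_zero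
  have h2 : ∀ i j, ContDiff ℝ ∞ fun x : Coord r q → ℝ => fderiv ℝ (fun y => coordMat y i j) x :=
    fun i j => (contDiff_coordMat i j).fderiv_right (by simp)
  have h3 : ∀ i j, ContDiff ℝ ∞ fun x : Coord r q → ℝ =>
      ∑ k, (coordMat x)⁻¹ i k • fderiv ℝ (fun y => coordMat y k j) x :=
    fun i j => ContDiff.sum fun k _ => (h1 i k).smul (h2 k j)
  exact ((h3 i j).add (h3 j i)).const_smul (1 / 2 : ℝ)

/-- The invariant metric in coordinates. -/
def metricInner {r q : ℕ} (x : Coord r q → ℝ) :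
    (Coord r q → ℝ) →L[ℝ] (Coord r q → ℝ) →L[ℝ] ℝ :=
  (1 / 2 : ℝ) • ∑ i, ∑ j, (vielbeinForm x i j).smulRight (vielbeinForm x j i)

theorem metricInner_eq {r q : ℕ} (x X Y : Coord r q → ℝ) :
    metricInner x X Y = 1 / 2 * ∑ i, ∑ j, vielbeinForm x i j X * vielbeinForm x j i Y := by
  simp only [metricInner, _root_.smul_apply, _root_.sum_apply,
    ContinuousLinearMap.smulRight_apply, smul_eq_mul]

theorem metricInner_apply {r q : ℕ} (s : S r q) (X Y : TangentSpace 𝓘(ℝ, Coord r q → ℝ) s) :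
    metricInner (coordHomeo r q s) X Y = metricForm s X Y := by
  have h := vielbeinForm_apply s X
  have h' := vielbeinForm_apply s Y
  refine (metricInner_eq _ _ _).trans ?_
  simp only [metricForm, trace, Matrix.mul_apply, diag_apply, ← h, ← h']

theorem contDiff_metricInner (r q : ℕ) : ContDiff ℝ ∞ (metricInner (r := r) (q := q)) := by
  refine contDiff_clm_apply_iff.mpr fun X => contDiff_clm_apply_iff.mpr fun Y => ?_
  simp only [metricInner_eq]
  exact contDiff_const.mul (ContDiff.sum fun i _ => ContDiff.sum fun j _ =>
    ((contDiff_vielbeinForm i j).clm_apply contDiff_const).mul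
      ((contDiff_vielbeinForm j i).clm_apply contDiff_const))

theorem vielbein_symm {r q : ℕ} (s : S r q) (X : TangentSpace 𝓘(ℝ, Coord r q → ℝ) s)
    (i j : Idx r q) : vielbein s X i j = vielbein s X j i := by
  simp [vielbein, add_comm]

theorem metricForm_self {r q : ℕ} (s : S r q) (X : TangentSpace 𝓘(ℝ, Coord r q → ℝ) s) :
    metricForm s X X = 1 / 2 * ∑ i, ∑ j, vielbein s X i j ^ 2 := by
  simp only [metricForm, trace, Matrix.mul_apply, diag_apply, sq]
  congr 1
  exact Finset.sum_congr rfl fun i _ => Finset.sum_congr rfl fun j _ => by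
    rw [vielbein_symm s X j i]

theorem dL_blockTriangular {r q : ℕ} (s : S r q) (X : TangentSpace 𝓘(ℝ, Coord r q → ℝ) s) :
    BlockTriangular (dL s X) pos := fun i j h => by
  have h0 : (fun x : Coord r q → ℝ => coordMat x i j) = fun _ => 0 :=
    funext fun x => coordMat_blockTriangular x h
  rw [dL_apply, h0, fderiv_fun_const]
  rfl

theorem theta_blockTriangular {r q : ℕ} (s : S r q) (X : TangentSpace 𝓘(ℝ, Coord r q → ℝ) s) :
    BlockTriangular (theta s X) pos :=
  (inv_blockTriangular_pos s.2.1 s.2.2).2.1.mul (dL_blockTriangular s X)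

/-- If all entries of a curve of matrices have zero velocity, so have their solvable coordinates. -/
theorem hasDerivAt_coordOf_zero {r q : ℕ} {M : ℝ → Matrix (Idx r q) (Idx r q) ℝ} {t : ℝ}
    (h : ∀ i j, HasDerivAt (fun t => M t i j) 0 t) (hd : ∀ i, 0 < M t i i) (c : Coord r q) :
    HasDerivAt (fun t => coordOf (M t) c) 0 t := by
  rcases c with ⟨⟨i, j⟩, hij⟩ | ⟨i, a⟩ | ⟨⟨i, j⟩, hij⟩
  · by_cases e : i = j
    · simp only [coordOf, e, if_true]
      simpa using (h _ _).log (hd _).ne'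
    · simp only [coordOf, e, if_false]
      exact h _ _
  · exact h _ _
  · have h1 := HasDerivAt.fun_sum (u := Finset.univ) fun k (_ : k ∈ Finset.univ) =>
      (h (Sum.inl i) (Sum.inr (Sum.inr k))).mul (h (Sum.inl j) (Sum.inl k))
    have h2 := HasDerivAt.fun_sum (u := Finset.univ) fun a (_ : a ∈ Finset.univ) =>
      (h (Sum.inl i) (Sum.inr (Sum.inl a))).mul (h (Sum.inl j) (Sum.inr (Sum.inl a)))
    have h3 := h1.add (h2.const_mul (1 / 2))
    simp only [zero_mul, mul_zero, add_zero, Finset.sum_const_zero] at h3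
    exact h3

/-- The inclusion of `S` into matrices is an immersion. -/
theorem eq_zero_of_dL_eq_zero {r q : ℕ} (s : S r q) (X : TangentSpace 𝓘(ℝ, Coord r q → ℝ) s)
    (h : dL s X = 0) : X = 0 := by
  let X' : Coord r q → ℝ := X
  suffices hX : X' = 0 from hX
  have hc : HasDerivAt (fun t : ℝ => coordHomeo r q s + t • X') X' 0 := by
    simpa using ((hasDerivAt_id (0 : ℝ)).smul_const X').const_add (coordHomeo r q s)
  have h1 : ∀ i j, HasDerivAt (fun t : ℝ => coordMat (coordHomeo r q s + t • X') i j) 0 0 := by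
    intro i j
    have h2 : HasFDerivAt (fun x : Coord r q → ℝ => coordMat x i j)
        (fderiv ℝ (fun x : Coord r q → ℝ => coordMat x i j) (coordHomeo r q s))
        (coordHomeo r q s + (0 : ℝ) • X') := by
      rw [zero_smul, add_zero]
      exact ((contDiff_coordMat i j).differentiable (by simp) _).hasFDerivAt
    have h3 := h2.comp_hasDerivAt (0 : ℝ) hc
    have h4 : fderiv ℝ (fun x : Coord r q → ℝ => coordMat x i j) (coordHomeo r q s) X' = 0 := by
      rw [← dL_apply s i j X, h]; rfl
    rwa [h4] at h3
  funext c
  have h5 := hasDerivAt_coordOf_zero h1 (fun i => coordMat_diag _ i) c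
  simp only [coordOf_coordMat] at h5
  exact ((hasDerivAt_pi.mp hc c).unique h5)

theorem eq_zero_of_vielbein_eq_zero {r q : ℕ} (s : S r q)
    (X : TangentSpace 𝓘(ℝ, Coord r q → ℝ) s) (h : vielbein s X = 0) : X = 0 := by
  have hs : ∀ i j, theta s X i j = -theta s X j i := fun i j => by
    have := congrFun (congrFun h i) j
    simp [vielbein] at this
    linarith
  -- an upper triangular skew-symmetric matrix vanishes
  have h0 : theta s X = 0 := by
    ext i j
    rcases lt_trichotomy (pos i) (pos j) with hij | hij | hij
    · rw [hs, theta_blockTriangular s X hij]; simp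
    · obtain rfl := pos_injective hij
      have := hs i i
      rw [Matrix.zero_apply]; linarith
    · exact theta_blockTriangular s X hij
  refine eq_zero_of_dL_eq_zero s X ?_
  have h1 := (inv_blockTriangular_pos s.2.1 s.2.2).1
  change Lmat s * (Lmat s)⁻¹ = 1 at h1
  rw [← Matrix.one_mul (dL s X), ← h1, Matrix.mul_assoc]
  change Lmat s * theta s X = 0
  rw [h0, Matrix.mul_zero]

theorem metricForm_pos {r q : ℕ} (s : S r q) (X : TangentSpace 𝓘(ℝ, Coord r q → ℝ) s)
    (hX : X ≠ 0) : 0 < metricForm s X X := by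
  rw [metricForm_self]
  refine mul_pos (by norm_num) (lt_of_le_of_ne (by positivity) fun h => hX ?_)
  refine eq_zero_of_vielbein_eq_zero s X ?_
  ext i j
  have h1 := (Finset.sum_eq_zero_iff_of_nonneg (fun i _ => by positivity)).mp h.symm i
    (Finset.mem_univ i)
  have h2 := (Finset.sum_eq_zero_iff_of_nonneg (fun i _ => by positivity)).mp h1 j
    (Finset.mem_univ j)
  simpa using h2

/-- The vielbein is injective on a finite-dimensional space, so it is antilipschitz and the unit ball
of the metric is bounded. -/
theorem isVonNBounded_metricInner {r q : ℕ} (s : S r q) :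
    Bornology.IsVonNBounded ℝ
      {v : Coord r q → ℝ | metricInner (coordHomeo r q s) v v < 1} := by
  rw [NormedSpace.isVonNBounded_iff]
  let f : (Coord r q → ℝ) →L[ℝ] (Idx r q × Idx r q → ℝ) :=
    ContinuousLinearMap.pi fun p => vielbeinForm (coordHomeo r q s) p.1 p.2
  obtain ⟨K, -, hK⟩ := LinearMap.exists_antilipschitzWith f.toLinearMap <| by
    rw [LinearMap.ker_eq_bot']
    intro v hv
    refine eq_zero_of_vielbein_eq_zero s v ?_
    ext i j
    exact (vielbeinForm_apply s v i j).symm.trans (congrFun hv (i, j))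
  refine (hK.isBounded_preimage (Metric.isBounded_closedBall (x := 0) (r := 2))).subset ?_
  intro v hv
  have hv : metricInner (coordHomeo r q s) v v < 1 := hv
  rw [metricInner_apply s v v, metricForm_self s v] at hv
  rw [Set.mem_preimage, mem_closedBall_zero_iff, pi_norm_le_iff_of_nonneg (by norm_num)]
  rintro ⟨i, j⟩
  change ‖vielbeinForm (coordHomeo r q s) i j v‖ ≤ 2
  rw [vielbeinForm_apply s v]
  have h1 : vielbein s v i j ^ 2 ≤ ∑ i, ∑ j, vielbein s v i j ^ 2 :=
    (Finset.single_le_sum (f := fun j => vielbein s v i j ^ 2) (fun j _ => by positivity)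
      (Finset.mem_univ j)).trans (Finset.single_le_sum (f := fun i => ∑ j, vielbein s v i j ^ 2)
      (fun j _ => by positivity) (Finset.mem_univ i))
  rw [Real.norm_eq_abs, abs_le]
  constructor <;> nlinarith

/-- The invariant Riemannian metric `ds² = ½ Tr 𝕍²`. -/
def metric (r q : ℕ) : Bundle.ContMDiffRiemannianMetric 𝓘(ℝ, Coord r q → ℝ) ∞ (Coord r q → ℝ)
    (fun s : S r q => TangentSpace 𝓘(ℝ, Coord r q → ℝ) s) where
  inner s := metricInner (coordHomeo r q s)
  symm s v w := by
    refine (metricInner_apply s v w).trans (Eq.trans ?_ (metricInner_apply s w v).symm)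
    rw [metricForm, metricForm, trace_mul_comm]
  pos s v hv := by
    exact (metricForm_pos s v hv).trans_eq (metricInner_apply s v v).symm
  isVonNBounded s := isVonNBounded_metricInner s
  contMDiff := contMDiff_bilinear (contDiff_metricInner r q)

theorem metric_inner {r q : ℕ} (s : S r q) (X Y : TangentSpace 𝓘(ℝ, Coord r q → ℝ) s) :
    (metric r q).inner s X Y = metricForm s X Y := metricInner_apply s X Y

/-! ### Lengths of paths and the action of `U` -/

section Length

variable {r q : ℕ}

/-- The tangent spaces of `S` with the norms of the invariant metric. -/
local instance riemannianBundle (r q : ℕ) :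
    Bundle.RiemannianBundle (fun s : S r q => TangentSpace 𝓘(ℝ, Coord r q → ℝ) s) :=
  ⟨(metric r q).toRiemannianMetric⟩

theorem enorm_tangent (s : S r q) (X : TangentSpace 𝓘(ℝ, Coord r q → ℝ) s) :
    ‖X‖ₑ = ENNReal.ofReal √(metricForm s X X) := by
  rw [← ofReal_norm, norm_eq_sqrt_real_inner (F := TangentSpace 𝓘(ℝ, Coord r q → ℝ) s) X]
  congr 2
  exact metric_inner s X X

theorem geodesicEDist_metric (u v : S r q) :
    geodesicEDist 𝓘(ℝ, Coord r q → ℝ) (metric r q) u v =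
      riemannianEDist 𝓘(ℝ, Coord r q → ℝ) u v := rfl

theorem hasDerivAt_Lmat {γ : ℝ → S r q} {t : ℝ}
    (h : MDifferentiableAt 𝓘(ℝ, ℝ) 𝓘(ℝ, Coord r q → ℝ) γ t) (i j : Idx r q) :
    HasDerivAt (fun t => Lmat (γ t) i j)
      (dL (γ t) (mfderiv 𝓘(ℝ, ℝ) 𝓘(ℝ, Coord r q → ℝ) γ t (1 : ℝ)) i j) t := by
  have h1 : MDifferentiableAt 𝓘(ℝ, Coord r q → ℝ) 𝓘(ℝ, ℝ) (fun s : S r q => Lmat s i j) (γ t) :=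
    (contMDiff_Lmat_apply i j).mdifferentiable (by simp) _
  have h2 := h1.hasMFDerivAt.comp t h.hasMFDerivAt
  let D : ℝ →L[ℝ] ℝ := (mfderiv 𝓘(ℝ, Coord r q → ℝ) 𝓘(ℝ, ℝ) (fun s : S r q => Lmat s i j)
    (γ t)).comp (mfderiv 𝓘(ℝ, ℝ) 𝓘(ℝ, Coord r q → ℝ) γ t)
  have h3 : HasFDerivAt (fun t => Lmat (γ t) i j) D t := h2.hasFDerivAt
  exact h3.hasDerivAt

theorem Lmat_mul_inv (s : S r q) : Lmat s * (Lmat s)⁻¹ = 1 :=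
  (inv_blockTriangular_pos s.2.1 s.2.2).1

theorem inv_mul_Lmat (s : S r q) : (Lmat s)⁻¹ * Lmat s = 1 := mul_eq_one_comm.mp (Lmat_mul_inv s)

/-- The metric in terms of `𝓜` and its differential: `ds² = ⅛ Tr (𝓜⁻¹ d𝓜)²`. -/
theorem metricForm_eq_trace (s : S r q) (X : TangentSpace 𝓘(ℝ, Coord r q → ℝ) s)
    {N : Matrix (Idx r q) (Idx r q) ℝ} (hN : N = dL s X * (Lmat s)ᵀ + Lmat s * (dL s X)ᵀ) :
    metricForm s X X = 1 / 8 * ((calM s)⁻¹ * N * ((calM s)⁻¹ * N)).trace := by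
  have h1 : (Lmat s)⁻¹ᵀ * (Lmat s)ᵀ = 1 := by rw [← transpose_mul, Lmat_mul_inv, transpose_one]
  have h2 : (Lmat s)ᵀ * (Lmat s)⁻¹ᵀ = 1 := mul_eq_one_comm.mp h1
  have hM : (calM s)⁻¹ = (Lmat s)⁻¹ᵀ * (Lmat s)⁻¹ := by
    refine Matrix.inv_eq_right_inv ?_
    rw [calM, Matrix.mul_assoc, ← Matrix.mul_assoc (Lmat s)ᵀ, h2, Matrix.one_mul, Lmat_mul_inv]
  have hV : (calM s)⁻¹ * N = (2 : ℝ) • ((Lmat s)⁻¹ᵀ * vielbein s X * (Lmat s)ᵀ) := by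
    rw [hM, hN, vielbein, theta, Matrix.mul_smul, Matrix.smul_mul, smul_smul]
    norm_num
    simp only [Matrix.mul_add, Matrix.add_mul, Matrix.mul_assoc]
    rw [← Matrix.mul_assoc (Lmat s)⁻¹ (Lmat s), inv_mul_Lmat, Matrix.one_mul, h1, Matrix.mul_one]
  rw [hV, Matrix.smul_mul, Matrix.mul_smul, trace_smul, trace_smul, metricForm]
  have : ((Lmat s)⁻¹ᵀ * vielbein s X * (Lmat s)ᵀ *
      ((Lmat s)⁻¹ᵀ * vielbein s X * (Lmat s)ᵀ)).trace = (vielbein s X * vielbein s X).trace := by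
    calc _ = ((Lmat s)⁻¹ᵀ *
          (vielbein s X * ((Lmat s)ᵀ * (Lmat s)⁻¹ᵀ) * vielbein s X * (Lmat s)ᵀ)).trace := by
          simp only [Matrix.mul_assoc]
      _ = _ := by
          rw [h2, Matrix.mul_one, trace_mul_comm, Matrix.mul_assoc _ (Lmat s)ᵀ, h2, Matrix.mul_one]
  rw [this]
  simp only [smul_eq_mul]
  ring

theorem hasDerivAt_calM {γ : ℝ → S r q} {t : ℝ}
    (h : MDifferentiableAt 𝓘(ℝ, ℝ) 𝓘(ℝ, Coord r q → ℝ) γ t) (i j : Idx r q) :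
    HasDerivAt (fun t => calM (γ t) i j)
      ((dL (γ t) (mfderiv 𝓘(ℝ, ℝ) 𝓘(ℝ, Coord r q → ℝ) γ t (1 : ℝ)) * (Lmat (γ t))ᵀ +
        Lmat (γ t) * (dL (γ t) (mfderiv 𝓘(ℝ, ℝ) 𝓘(ℝ, Coord r q → ℝ) γ t (1 : ℝ)))ᵀ) i j) t := by
  have h1 := HasDerivAt.fun_sum (u := Finset.univ) fun k (_ : k ∈ Finset.univ) =>
      (hasDerivAt_Lmat h i k).mul (hasDerivAt_Lmat h j k)
  rw [Finset.sum_add_distrib] at h1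
  exact h1

/-- The action of an element of `U` on `U / H`, read in `S`, is smooth. -/
theorem exists_contMDiff_action (A : U r q) :
    ∃ φ : S r q → S r q, ContMDiff 𝓘(ℝ, Coord r q → ℝ) 𝓘(ℝ, Coord r q → ℝ) ∞ φ ∧
      ∀ s, calM (φ s) = matU A * calM s * (matU A)ᵀ := by
  obtain ⟨f, h1, h2⟩ := exists_contDiff_iwasawa
    (fun x : Coord r q → ℝ => A * (coordInv x : U r q))
    (contDiff_mul_apply (fun i j => contDiff_const) contDiff_coordMat)
  have h3 : ContDiff ℝ ∞ fun x => coordOf (Lmat (f x)) :=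
    contDiff_coordOf h1 fun x i => Lmat_diag _ i
  have h4 : f = coordInv ∘ fun x => coordOf (Lmat (f x)) :=
    funext fun x => ((coordEquiv r q).left_inv (f x)).symm
  refine ⟨f ∘ coordHomeo r q, ?_, fun s => ?_⟩
  · rw [h4]
    exact ((contMDiff_coordInv r q).comp h3.contMDiff).comp (contMDiff_coordHomeo r q)
  · have h5 : coordInv (coordHomeo r q s) = s := (coordEquiv r q).left_inv s
    rw [Function.comp, h2, matU_mul, transpose_mul, h5]
    simp only [Matrix.mul_assoc, calM]
    rfl

/-- Paths related by the action of `U` have the same speed, since `Tr (𝓜⁻¹ d𝓜)²` does not change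
when `𝓜` is replaced by `A 𝓜 Aᵀ`. -/
theorem metricForm_action {A : U r q} {γ δ : ℝ → S r q} {t : ℝ}
    (hγ : MDifferentiableAt 𝓘(ℝ, ℝ) 𝓘(ℝ, Coord r q → ℝ) γ t)
    (hδ : MDifferentiableAt 𝓘(ℝ, ℝ) 𝓘(ℝ, Coord r q → ℝ) δ t)
    (h : ∀ t, calM (δ t) = matU A * calM (γ t) * (matU A)ᵀ) :
    metricForm (δ t) (mfderiv 𝓘(ℝ, ℝ) 𝓘(ℝ, Coord r q → ℝ) δ t (1 : ℝ))
        (mfderiv 𝓘(ℝ, ℝ) 𝓘(ℝ, Coord r q → ℝ) δ t (1 : ℝ)) =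
      metricForm (γ t) (mfderiv 𝓘(ℝ, ℝ) 𝓘(ℝ, Coord r q → ℝ) γ t (1 : ℝ))
        (mfderiv 𝓘(ℝ, ℝ) 𝓘(ℝ, Coord r q → ℝ) γ t (1 : ℝ)) := by
  obtain ⟨N, hN⟩ : ∃ N, N = dL (γ t) (mfderiv 𝓘(ℝ, ℝ) 𝓘(ℝ, Coord r q → ℝ) γ t (1 : ℝ)) *
    (Lmat (γ t))ᵀ + Lmat (γ t) *
      (dL (γ t) (mfderiv 𝓘(ℝ, ℝ) 𝓘(ℝ, Coord r q → ℝ) γ t (1 : ℝ)))ᵀ := ⟨_, rfl⟩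
  have hA1 : matU A * (matU A)⁻¹ = 1 := by rw [← matU_inv_eq, ← matU_mul, mul_inv_cancel, matU_one]
  have hA2 : (matU A)⁻¹ * matU A = 1 := mul_eq_one_comm.mp hA1
  have hN' : matU A * N * (matU A)ᵀ =
      dL (δ t) (mfderiv 𝓘(ℝ, ℝ) 𝓘(ℝ, Coord r q → ℝ) δ t (1 : ℝ)) * (Lmat (δ t))ᵀ +
        Lmat (δ t) * (dL (δ t) (mfderiv 𝓘(ℝ, ℝ) 𝓘(ℝ, Coord r q → ℝ) δ t (1 : ℝ)))ᵀ := by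
    ext i j
    refine HasDerivAt.unique ?_ (hasDerivAt_calM hδ i j)
    simp only [h, Matrix.mul_apply]
    refine HasDerivAt.fun_sum fun k _ => HasDerivAt.mul_const (HasDerivAt.fun_sum fun l _ => ?_) _
    rw [hN]
    exact (hasDerivAt_calM hγ l k).const_mul _
  rw [metricForm_eq_trace _ _ hN, metricForm_eq_trace _ _ hN', h]
  have hA3 : (matU A)ᵀ * ((matU A)ᵀ)⁻¹ = 1 := by
    rw [← transpose_nonsing_inv, ← transpose_mul, hA2, transpose_one]
  have e : (matU A * calM (γ t) * (matU A)ᵀ)⁻¹ * (matU A * N * (matU A)ᵀ) =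
      ((matU A)ᵀ)⁻¹ * ((calM (γ t))⁻¹ * N) * (matU A)ᵀ := by
    rw [Matrix.mul_inv_rev, Matrix.mul_inv_rev]
    calc _ = ((matU A)ᵀ)⁻¹ * (calM (γ t))⁻¹ * ((matU A)⁻¹ * matU A) * N * (matU A)ᵀ := by
          simp only [Matrix.mul_assoc]
      _ = _ := by rw [hA2]; simp only [Matrix.mul_one, Matrix.mul_assoc]
  rw [e]
  congr 1
  calc _ = (((matU A)ᵀ)⁻¹ * ((calM (γ t))⁻¹ * N * ((matU A)ᵀ * ((matU A)ᵀ)⁻¹) *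
        ((calM (γ t))⁻¹ * N) * (matU A)ᵀ)).trace := by
        simp only [Matrix.mul_assoc]
    _ = _ := by
        rw [trace_mul_comm, hA3, Matrix.mul_one, Matrix.mul_assoc _ (matU A)ᵀ, hA3, Matrix.mul_one]

theorem geodesicEDist_action_le (A : U r q) {u v u' v' : S r q}
    (hu : calM u' = matU A * calM u * (matU A)ᵀ) (hv : calM v' = matU A * calM v * (matU A)ᵀ) :
    geodesicEDist 𝓘(ℝ, Coord r q → ℝ) (metric r q) u' v' ≤
      geodesicEDist 𝓘(ℝ, Coord r q → ℝ) (metric r q) u v := by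
  rw [geodesicEDist_metric, geodesicEDist_metric]
  obtain ⟨φ, hφ, hφM⟩ := exists_contMDiff_action A
  refine le_of_forall_gt fun ρ hρ => ?_
  obtain ⟨γ, h0, h1, hγ, hlen, -, -⟩ :=
    exists_lt_locally_constant_of_riemannianEDist_lt hρ zero_lt_one
  have hδ : ContMDiff 𝓘(ℝ, ℝ) 𝓘(ℝ, Coord r q → ℝ) 1 (φ ∘ γ) := (hφ.of_le (by simp)).comp hγ
  refine (riemannianEDist_le_pathELength hδ.contMDiffOn (a := 0) (b := 1) ?_ ?_
    zero_le_one).trans_lt (lt_of_eq_of_lt ?_ hlen)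
  · exact calM_injective (by rw [Function.comp, hφM, h0, hu])
  · exact calM_injective (by rw [Function.comp, hφM, h1, hv])
  · rw [pathELength_eq_lintegral_mfderiv_Icc, pathELength_eq_lintegral_mfderiv_Icc]
    refine MeasureTheory.lintegral_congr fun t => ?_
    rw [enorm_tangent, enorm_tangent]
    congr 2
    exact metricForm_action (A := A) (hγ.mdifferentiable one_ne_zero t)
      (hδ.mdifferentiable one_ne_zero t) fun t => hφM (γ t)

/-- The geodesic distance is invariant under the action of `U`. -/
theorem geodesicEDist_action (A : U r q) {u v u' v' : S r q}
    (hu : calM u' = matU A * calM u * (matU A)ᵀ) (hv : calM v' = matU A * calM v * (matU A)ᵀ) :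
    geodesicEDist 𝓘(ℝ, Coord r q → ℝ) (metric r q) u' v' =
      geodesicEDist 𝓘(ℝ, Coord r q → ℝ) (metric r q) u v := by
  have h1 : matU A⁻¹ * matU A = 1 := by rw [← matU_mul, inv_mul_cancel, matU_one]
  have h2 : (matU A)ᵀ * (matU A⁻¹)ᵀ = 1 := by rw [← transpose_mul, h1, transpose_one]
  have h3 : ∀ {s s' : S r q}, calM s' = matU A * calM s * (matU A)ᵀ →
      calM s = matU A⁻¹ * calM s' * (matU A⁻¹)ᵀ := fun {s s'} h => by
    rw [h]
    calc _ = (matU A⁻¹ * matU A) * calM s * ((matU A)ᵀ * (matU A⁻¹)ᵀ) := by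
          rw [h1, h2, Matrix.one_mul, Matrix.mul_one]
      _ = _ := by simp only [Matrix.mul_assoc]
  exact le_antisymm (geodesicEDist_action_le A hu hv)
    (geodesicEDist_action_le A⁻¹ (h3 hu) (h3 hv))

/-! ### Lower bound on distances by the diagonal part -/

/-- The diagonal part of the vielbein bounds `ds²` from below. -/
theorem abs_sum_mul_vielbein_le (s : S r q) (X : TangentSpace 𝓘(ℝ, Coord r q → ℝ) s)
    {c : Idx r q → ℝ} (hc : 2 * ∑ i, c i ^ 2 ≤ 1) :
    |∑ i, c i * vielbein s X i i| ≤ √(metricForm s X X) := by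
  refine Real.abs_le_sqrt ?_
  rw [metricForm_self]
  have h1 := Finset.sum_mul_sq_le_sq_mul_sq Finset.univ c fun i => vielbein s X i i
  have h2 : ∑ i, vielbein s X i i ^ 2 ≤ ∑ i, ∑ j, vielbein s X i j ^ 2 :=
    Finset.sum_le_sum fun i _ => Finset.single_le_sum (f := fun j => vielbein s X i j ^ 2)
      (fun j _ => by positivity) (Finset.mem_univ i)
  have h3 : 0 ≤ ∑ i, vielbein s X i i ^ 2 := by positivity
  have h4 : 0 ≤ ∑ i, c i ^ 2 := by positivity
  nlinarith

/-- On the diagonal, the vielbein is the logarithmic differential of `𝕃`. -/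
theorem vielbein_apply_diag (s : S r q) (X : TangentSpace 𝓘(ℝ, Coord r q → ℝ) s) (i : Idx r q) :
    dL s X i i / Lmat s i i = vielbein s X i i := by
  have h1 : theta s X i i = (Lmat s)⁻¹ i i * dL s X i i :=
    mul_apply_diag (inv_blockTriangular_pos s.2.1 s.2.2).2.1 (dL_blockTriangular s X) i
  have h2 := mul_apply_diag s.2.1 (inv_blockTriangular_pos s.2.1 s.2.2).2.1 i
  change (Lmat s * (Lmat s)⁻¹) i i = Lmat s i i * (Lmat s)⁻¹ i i at h2
  rw [Lmat_mul_inv, one_apply_eq] at h2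
  have h3 := (Lmat_diag s i).ne'
  have h4 : vielbein s X i i = theta s X i i := by simp [vielbein]; ring
  rw [h4, h1, eq_div_iff_mul_eq h3 |>.mpr (show (Lmat s)⁻¹ i i * Lmat s i i = 1 by linarith)]
  ring

/-- The functions `s ↦ ∑ cᵢ log 𝕃(s)ᵢᵢ` with `2 ∑ cᵢ² ≤ 1` do not expand distances. -/
theorem sum_mul_log_le_geodesicEDist (w : S r q) {c : Idx r q → ℝ} (hc : 2 * ∑ i, c i ^ 2 ≤ 1) :
    ENNReal.ofReal (∑ i, c i * Real.log (Lmat w i i)) ≤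
      geodesicEDist 𝓘(ℝ, Coord r q → ℝ) (metric r q) 1 w := by
  rw [geodesicEDist_metric]
  refine le_of_forall_gt fun ρ hρ => ?_
  obtain ⟨γ, h0, h1, hγ, hlen, -, -⟩ :=
    exists_lt_locally_constant_of_riemannianEDist_lt hρ zero_lt_one
  refine lt_of_le_of_lt ?_ hlen
  have hd := hγ.mdifferentiable one_ne_zero
  let f : ℝ → ℝ := fun t => ∑ i, c i * Real.log (Lmat (γ t) i i)
  have hf : ContDiff ℝ 1 f := by
    refine ContDiff.sum fun i _ => contDiff_const.mul (ContDiff.log ?_ fun t => (Lmat_diag _ i).ne')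
    exact (((contMDiff_Lmat_apply i i).of_le (by simp)).comp hγ).contDiff
  have hf' : ∀ t, deriv f t =
      ∑ i, c i * vielbein (γ t) (mfderiv 𝓘(ℝ, ℝ) 𝓘(ℝ, Coord r q → ℝ) γ t (1 : ℝ)) i i := by
    intro t
    refine HasDerivAt.deriv (HasDerivAt.fun_sum fun i _ => HasDerivAt.const_mul _ ?_)
    rw [← vielbein_apply_diag]
    exact (hasDerivAt_Lmat (hd t) i i).log (Lmat_diag _ i).ne'
  have h3 := enorm_sub_le_lintegral_deriv_of_contDiffOn_Icc hf.contDiffOn (zero_le_one (α := ℝ))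
  have hf0 : f 0 = 0 := by
    have : ∀ i : Idx r q, Lmat (1 : S r q) i i = 1 := fun i => by
      rw [show Lmat (1 : S r q) = 1 from rfl, one_apply_eq]
    simp [f, h0, this]
  rw [hf0, sub_zero] at h3
  have hf1 : f 1 = ∑ i, c i * Real.log (Lmat w i i) := by simp only [f, h1]
  rw [← hf1]
  refine ((Real.ofReal_le_enorm _).trans h3).trans ?_
  rw [pathELength_eq_lintegral_mfderiv_Icc]
  refine MeasureTheory.lintegral_mono fun t => ?_
  rw [enorm_tangent, hf', ← ofReal_norm, Real.norm_eq_abs]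
  exact ENNReal.ofReal_le_ofReal (abs_sum_mul_vielbein_le _ _ hc)

end Length

/-! ### The Cartan decomposition -/

theorem exists_orthogonal_diagonalization {n : Type*} [Fintype n] [DecidableEq n]
    {m : Matrix n n ℝ} (hm : m.IsHermitian) :
    ∃ V : Matrix n n ℝ, Vᵀ * V = 1 ∧ m = V * diagonal hm.eigenvalues * Vᵀ := by
  refine ⟨hm.eigenvectorUnitary, ?_, ?_⟩
  · have := Unitary.coe_star_mul_self hm.eigenvectorUnitary
    rwa [star_eq_conjTranspose, conjTranspose_eq_transpose_of_trivial] at this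
  · have := hm.spectral_theorem
    rwa [Unitary.conjStarAlgAut_apply, star_eq_conjTranspose,
      conjTranspose_eq_transpose_of_trivial] at this

/-- A matrix with orthogonal columns factors as an orthogonal matrix times a diagonal one. -/
theorem exists_orthogonal_mul_diagonal {q r : ℕ} {C : Matrix (Fin q ⊕ Fin r) (Fin r) ℝ}
    {d : Fin r → ℝ} (hC : Cᵀ * C = diagonal d) :
    ∃ (W : Matrix (Fin q ⊕ Fin r) (Fin q ⊕ Fin r) ℝ) (σ : Fin r → ℝ), Wᵀ * W = 1 ∧
      C = W * (fromRows 0 (diagonal σ) : Matrix (Fin q ⊕ Fin r) (Fin r) ℝ) := by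
  let c : Fin r → EuclideanSpace ℝ (Fin q ⊕ Fin r) := fun i => WithLp.toLp 2 fun k => C k i
  have hc : ∀ i j, inner ℝ (c i) (c j) = diagonal d i j := fun i j => by
    rw [← hC]
    simp [c, PiLp.inner_apply, Matrix.mul_apply, mul_comm]
  let v : Fin q ⊕ Fin r → EuclideanSpace ℝ (Fin q ⊕ Fin r) :=
    Sum.elim 0 fun i => ‖c i‖⁻¹ • c i
  have hv : Orthonormal ℝ (Set.domRestrict (Sum.inr '' {i | c i ≠ 0}) v) := by
    constructor
    · rintro ⟨_, i, hi, rfl⟩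
      have : ‖c i‖ ≠ 0 := norm_ne_zero_iff.mpr hi
      change ‖‖c i‖⁻¹ • c i‖ = 1
      simp [norm_smul, this]
    · rintro ⟨_, i, hi, rfl⟩ ⟨_, j, hj, rfl⟩ hij
      have : i ≠ j := fun h => hij (by subst h; rfl)
      change inner ℝ (‖c i‖⁻¹ • c i) (‖c j‖⁻¹ • c j) = 0
      simp [inner_smul_left, inner_smul_right, hc, this]
  obtain ⟨b, hb⟩ := hv.exists_orthonormalBasis_extension_of_card_eq (by simp)
  refine ⟨of fun k l => b l k, fun i => ‖c i‖, ?_, ?_⟩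
  · ext k l
    have := orthonormal_iff_ite.mp b.orthonormal k l
    simp only [PiLp.inner_apply] at this
    simpa [Matrix.mul_apply, Matrix.one_apply, mul_comm] using this
  · ext k i
    rw [Matrix.mul_apply, Fintype.sum_sum_type, Finset.sum_eq_zero (by simp), zero_add,
      Finset.sum_eq_single i]
    · simp only [of_apply, fromRows_apply_inr, diagonal_apply_eq]
      by_cases h : c i = 0
      · rw [h, norm_zero, mul_zero]
        exact congrFun (congrArg WithLp.ofLp h) k
      · have : ‖c i‖ ≠ 0 := norm_ne_zero_iff.mpr h
        rw [hb _ ⟨i, h, rfl⟩]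
        simp only [v, Sum.elim_inr, PiLp.smul_apply, smul_eq_mul]
        field_simp
        rfl
    · intro j _ hj
      simp [hj]
    · simp

open scoped MatrixOrder in
/-- Uniqueness of the positive semidefinite square root. -/
theorem eq_of_mul_self_eq_of_posSemidef {n : Type*} [Fintype n] [DecidableEq n] {A B : Matrix n n ℝ}
    (hA : A.PosSemidef) (hB : B.PosSemidef) (h : A * A = B * B) : A = B := by
  rw [← CFC.sqrt_unique (a := A * A) rfl hA.nonneg, CFC.sqrt_unique h.symm hB.nonneg]

theorem transpose_Omega_mul_Omega (r q : ℕ) : (Omega r q)ᵀ * Omega r q = 1 :=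
  (mul_eq_one_comm_of_equiv (Equiv.sumComm _ _)).mp (Omega_mul_transpose r q)

/-- The diagonal of the Cartan generator with parameters `a`. -/
def cartanVec {r : ℕ} (q : ℕ) (a : Fin r → ℝ) : Idx r q → ℝ := Sum.elim a (Sum.elim 0 (-a))

theorem Omega_mul_diagonal_mul_transpose {r q : ℕ} (a : Fin r → ℝ) :
    Omega r q * diagonal (fun i => Real.exp (2 * cartanVec q a i)) * (Omega r q)ᵀ =
      fromBlocks (fromBlocks 1 0 0 (diagonal fun i => Real.cosh (2 * a i)))
        (fromRows 0 (diagonal fun i => Real.sinh (2 * a i)))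
        (fromCols 0 (diagonal fun i => Real.sinh (2 * a i)))
        (diagonal fun i => Real.cosh (2 * a i)) := by
  have h : (√2 : ℝ)⁻¹ * (√2)⁻¹ = 1 / 2 := by
    rw [← mul_inv, Real.mul_self_sqrt (by norm_num)]; norm_num
  have h' : ∀ x : ℝ, (√2 : ℝ)⁻¹ * x * (√2)⁻¹ = 1 / 2 * x := fun x => by rw [← h]; ring
  ext ((i | i) | i) ((j | j) | j) <;>
    simp [Omega, Matrix.mul_apply, Matrix.one_apply, diagonal_apply, cartanVec, Real.cosh_eq,
      Real.sinh_eq, h'] <;> split_ifs <;> simp_all <;> ring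

theorem calM_mul_etaT_mul {r q : ℕ} (w : S r q) : calM w * etaT r q * calM w = etaT r q := by
  calc _ = Lmat w * ((Lmat w)ᵀ * etaT r q * Lmat w) * (Lmat w)ᵀ := by
        simp only [calM, Matrix.mul_assoc]
    _ = _ := by
        rw [Lmat, matU_transpose_mul_etaT_mul, matU_mul_etaT_mul_transpose]

theorem calM_posDef {r q : ℕ} (w : S r q) : (calM w).PosDef := posDef_mul_transpose (w : U r q)

theorem posDef_Omega_conj {r q : ℕ} (w : S r q) :
    (Omega r q * calM w * (Omega r q)ᵀ).PosDef := by
  have h : Function.Injective (Omega r q).vecMul := fun x y hxy => by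
    have := congrArg (fun z => z ᵥ* (Omega r q)ᵀ) hxy
    simpa [vecMul_vecMul, Omega_mul_transpose] using this
  have := (calM_posDef w).mul_mul_conjTranspose_same h
  rwa [conjTranspose_eq_transpose_of_trivial] at this

theorem mBlock_posDef {r q : ℕ} (w : S r q) : (mBlock w).PosDef :=
  (posDef_Omega_conj w).submatrix Sum.inr_injective

/-- The element of `H` with given blocks in the `η_b` basis. -/
theorem exists_mem_Hc {r q : ℕ} {K₁ : Matrix (Fin q ⊕ Fin r) (Fin q ⊕ Fin r) ℝ}
    {K₂ : Matrix (Fin r) (Fin r) ℝ} (h₁ : K₁ * K₁ᵀ = 1) (h₂ : K₂ * K₂ᵀ = 1)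
    (hd : K₁.det * K₂.det = 1) :
    ∃ k ∈ Hc r q, matU k = (Omega r q)ᵀ * fromBlocks K₁ 0 0 K₂ * Omega r q := by
  obtain ⟨K, hK⟩ : ∃ K, K = fromBlocks K₁ 0 0 K₂ := ⟨_, rfl⟩
  have h₁' := mul_eq_one_comm.mp h₁
  have h₂' := mul_eq_one_comm.mp h₂
  have hKK : Kᵀ * K = 1 := by
    rw [hK, fromBlocks_transpose, fromBlocks_multiply]
    simp [h₁', h₂', fromBlocks_one]
  have hKη : Kᵀ * etaB r q * K = etaB r q := by
    rw [hK, etaB, fromBlocks_transpose, fromBlocks_multiply, fromBlocks_multiply]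
    simp [h₁', h₂']
  have hdet : ((Omega r q)ᵀ * K * Omega r q).det = 1 := by
    rw [det_conj_of_mul_eq_one (transpose_Omega_mul_Omega r q) (Omega_mul_transpose r q), hK,
      det_fromBlocks_zero₁₂, hd]
  have ht : ((Omega r q)ᵀ * K * Omega r q)ᵀ = (Omega r q)ᵀ * Kᵀ * Omega r q := by
    simp only [transpose_mul, transpose_transpose, Matrix.mul_assoc]
  have hη : Omega r q * etaT r q * (Omega r q)ᵀ = etaB r q := Omega_mul_etaT_mul_transpose r q
  have hη' : (Omega r q)ᵀ * etaB r q * Omega r q = etaT r q := by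
    rw [← hη]
    calc _ = ((Omega r q)ᵀ * Omega r q) * etaT r q * ((Omega r q)ᵀ * Omega r q) := by
          simp only [Matrix.mul_assoc]
      _ = _ := by rw [transpose_Omega_mul_Omega, Matrix.one_mul, Matrix.mul_one]
  refine ⟨⟨⟨_, hdet⟩, ?_⟩, ?_, by rw [← hK]; rfl⟩
  · change ((Omega r q)ᵀ * K * Omega r q)ᵀ * etaT r q * ((Omega r q)ᵀ * K * Omega r q) = etaT r q
    rw [ht]
    calc _ = (Omega r q)ᵀ * (Kᵀ * (Omega r q * etaT r q * (Omega r q)ᵀ) * K) * Omega r q := by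
          simp only [Matrix.mul_assoc]
      _ = _ := by rw [hη, hKη, hη']
  · change ((Omega r q)ᵀ * K * Omega r q)ᵀ * ((Omega r q)ᵀ * K * Omega r q) = 1
    rw [ht]
    calc _ = (Omega r q)ᵀ * (Kᵀ * (Omega r q * (Omega r q)ᵀ) * K) * Omega r q := by
          simp only [Matrix.mul_assoc]
      _ = _ := by
        rw [Omega_mul_transpose, Matrix.mul_one, hKK, Matrix.mul_one, transpose_Omega_mul_Omega]

/-- Signs, available because `1 ≤ r`, whose product corrects a determinant `x = ±1`. -/
theorem exists_sign_det {r : ℕ} (hr : 1 ≤ r) {x : ℝ} (hx : x * x = 1) :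
    ∃ ε : Fin r → ℝ, (∀ i, ε i * ε i = 1) ∧ (∏ i, ε i) * x = 1 := by
  refine ⟨fun i => if i = ⟨0, hr⟩ then x else 1, fun i => ?_, ?_⟩
  · dsimp only
    split_ifs <;> simp [hx]
  · rw [Finset.prod_ite_eq' ]
    simp [hx]

/-- Cartan decomposition: `𝓜(w)` is conjugate, by an element of `H`, to a diagonal matrix. The
parameters `a` are related to the eigenvalues of `𝔪(w)`, which are the numbers `cosh (2 aᵢ)`.

In the `η_b` basis `𝓜` has blocks `P`, `C`, `Cᵀ`, `𝔪`, and the invariance of `η_b` reads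
`P² = 1 + C Cᵀ`, `𝔪² = 1 + Cᵀ C`. So an orthogonal matrix `V` diagonalizing `𝔪` makes the columns of
`C V` orthogonal; normalizing and completing them gives the orthogonal matrix `W` for the other
block. The block `Wᵀ P W` is then the positive square root of a known diagonal matrix. -/
theorem exists_cartan {r q : ℕ} (hr : 1 ≤ r) (w : S r q) :
    ∃ k ∈ Hc r q, ∃ a : Fin r → ℝ,
      matU k * calM w * (matU k)ᵀ = diagonal (fun i => Real.exp (2 * cartanVec q a i)) ∧
      ∀ i, Real.cosh (2 * a i) = (mBlock_posDef w).isHermitian.eigenvalues i := by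
  obtain ⟨N, hN⟩ : ∃ N, N = Omega r q * calM w * (Omega r q)ᵀ := ⟨_, rfl⟩
  have hNp : N.PosDef := hN ▸ posDef_Omega_conj w
  obtain ⟨P, C, C', m, hPC⟩ : ∃ P C C' m, N = fromBlocks P C C' m :=
    ⟨_, _, _, _, (fromBlocks_toBlocks N).symm⟩
  have hm : mBlock w = m := by rw [mBlock, ← hN, hPC, toBlocks_fromBlocks₂₂]
  have hsymm : Nᵀ = N := by
    rw [← conjTranspose_eq_transpose_of_trivial]; exact hNp.isHermitian
  rw [hPC, fromBlocks_transpose, fromBlocks_inj] at hsymm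
  obtain ⟨hP, -, hC', hmt⟩ := hsymm
  have hPp : P.PosDef := by
    have := hNp.submatrix Sum.inl_injective
    rwa [hPC] at this
  have hη : N * etaB r q * N = etaB r q := by
    rw [hN, ← Omega_mul_etaT_mul_transpose]
    calc _ = Omega r q * (calM w * ((Omega r q)ᵀ * Omega r q) * etaT r q *
          ((Omega r q)ᵀ * Omega r q) * calM w) * (Omega r q)ᵀ := by simp only [Matrix.mul_assoc]
      _ = _ := by rw [transpose_Omega_mul_Omega, Matrix.mul_one, Matrix.mul_one, calM_mul_etaT_mul]
  rw [hPC, etaB, fromBlocks_multiply, fromBlocks_multiply, fromBlocks_inj] at hη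
  simp only [Matrix.mul_one, Matrix.mul_zero, add_zero, zero_add, Matrix.mul_neg,
    Matrix.neg_mul] at hη
  obtain ⟨e1, -, -, e4⟩ := hη
  obtain ⟨V₀, hV₀, hmV₀⟩ := exists_orthogonal_diagonalization (mBlock_posDef w).isHermitian
  have hμpos := (mBlock_posDef w).eigenvalues_pos
  obtain ⟨μ, hμ⟩ : ∃ μ, μ = (mBlock_posDef w).isHermitian.eigenvalues := ⟨_, rfl⟩
  rw [← hμ] at hmV₀ hμpos ⊢
  rw [hm] at hmV₀
  have hV₀' := mul_eq_one_comm.mp hV₀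
  have hVm : V₀ᵀ * m * V₀ = diagonal μ := by
    rw [hmV₀]
    calc _ = (V₀ᵀ * V₀) * diagonal μ * (V₀ᵀ * V₀) := by simp only [Matrix.mul_assoc]
      _ = _ := by rw [hV₀, Matrix.one_mul, Matrix.mul_one]
  have hCC : Cᵀ * C = m * m - 1 := by
    rw [hC']
    have : C' * C = m * m + (C' * C + -(m * m)) := by abel
    rw [this, e4]; abel
  have hCV : (C * V₀)ᵀ * (C * V₀) = diagonal fun i => μ i * μ i - 1 := by
    calc _ = V₀ᵀ * (Cᵀ * C) * V₀ := by simp only [transpose_mul, Matrix.mul_assoc]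
      _ = (V₀ᵀ * m * (V₀ * V₀ᵀ) * m * V₀) - V₀ᵀ * V₀ := by
          rw [hCC, hV₀', Matrix.mul_sub, Matrix.sub_mul, Matrix.mul_one, Matrix.mul_one]
          simp only [Matrix.mul_assoc]
      _ = (V₀ᵀ * m * V₀) * (V₀ᵀ * m * V₀) - V₀ᵀ * V₀ := by simp only [Matrix.mul_assoc]
      _ = _ := by rw [hVm, hV₀, diagonal_mul_diagonal, ← diagonal_one, diagonal_sub]
  obtain ⟨W, σ₀, hW, hσ₀⟩ := exists_orthogonal_mul_diagonal hCV
  have hW' := mul_eq_one_comm.mp hW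
  have hσμ₀ : ∀ i, σ₀ i * σ₀ i = μ i * μ i - 1 := fun i => by
    have h : (C * V₀)ᵀ * (C * V₀) = diagonal fun i => σ₀ i * σ₀ i := by
      rw [hσ₀, transpose_mul, Matrix.mul_assoc, ← Matrix.mul_assoc Wᵀ, hW, Matrix.one_mul,
        transpose_fromRows, fromCols_mul_fromRows]
      simp
    rw [hCV] at h
    exact (congrFun (diagonal_injective h) i).symm
  -- the signs of the columns of `V₀` are adjusted so that the determinant becomes one
  obtain ⟨ε, hε, hεd⟩ := exists_sign_det hr (x := W.det * V₀.det) (by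
    have h1 := congrArg det hW
    have h2 := congrArg det hV₀
    rw [det_mul, det_transpose, det_one] at h1 h2
    calc _ = (W.det * W.det) * (V₀.det * V₀.det) := by ring
      _ = 1 := by rw [h1, h2, one_mul])
  have hεε : diagonal ε * diagonal ε = 1 := by
    rw [diagonal_mul_diagonal, ← diagonal_one]; congr 1; exact funext hε
  obtain ⟨σ, hσ⟩ : ∃ σ : Fin r → ℝ, σ = fun i => σ₀ i * ε i := ⟨_, rfl⟩
  obtain ⟨V, hVdef⟩ : ∃ V, V = V₀ * diagonal ε := ⟨_, rfl⟩
  have hV : Vᵀ * V = 1 := by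
    rw [hVdef, transpose_mul, diagonal_transpose, Matrix.mul_assoc, ← Matrix.mul_assoc V₀ᵀ, hV₀,
      Matrix.one_mul, hεε]
  have hVmV : Vᵀ * m * V = diagonal μ := by
    rw [hVdef, transpose_mul, diagonal_transpose]
    calc _ = diagonal ε * (V₀ᵀ * m * V₀) * diagonal ε := by simp only [Matrix.mul_assoc]
      _ = _ := by
        rw [hVm, diagonal_mul_diagonal, diagonal_mul_diagonal]
        congr 1
        funext i
        linear_combination μ i * hε i
  have hCV' : Wᵀ * C * V = fromRows 0 (diagonal σ) := by
    rw [hVdef, Matrix.mul_assoc, ← Matrix.mul_assoc C, hσ₀, Matrix.mul_assoc W, ← Matrix.mul_assoc,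
      hW, Matrix.one_mul, fromRows_mul, diagonal_mul_diagonal, Matrix.zero_mul, hσ]
  have hσμ : ∀ i, σ i * σ i = μ i * μ i - 1 := fun i => by
    rw [← hσμ₀ i, hσ]; linear_combination σ₀ i * σ₀ i * hε i
  let a : Fin r → ℝ := fun i => Real.arsinh (σ i) / 2
  have hsinh : ∀ i, Real.sinh (2 * a i) = σ i := fun i => by
    simp only [a]
    rw [mul_div_cancel₀ _ two_ne_zero, Real.sinh_arsinh]
  have hcosh : ∀ i, Real.cosh (2 * a i) = μ i := fun i => by
    have h1 := Real.cosh_sq (2 * a i)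
    rw [hsinh] at h1
    have h2 := Real.cosh_pos (2 * a i)
    have h3 := hσμ i
    have h4 := hμpos i
    nlinarith
  have hPW : Wᵀ * P * W = fromBlocks 1 0 0 (diagonal μ) := by
    refine eq_of_mul_self_eq_of_posSemidef ?_ ?_ ?_
    · have := hPp.posSemidef.conjTranspose_mul_mul_same W
      rwa [conjTranspose_eq_transpose_of_trivial] at this
    · rw [← diagonal_one, fromBlocks_diagonal]
      refine PosSemidef.diagonal ?_
      rintro (i | i)
      · simp
      · simpa using (hμpos i).le
    · have h1 : P * P = 1 + C * Cᵀ := by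
        rw [hC']
        have : P * P = (P * P + -(C * C')) + C * C' := by abel
        rw [this, e1]
      have hVV' := mul_eq_one_comm.mp hV
      have hd : 1 + diagonal σ * diagonal σ = diagonal μ * diagonal μ := by
        rw [diagonal_mul_diagonal, diagonal_mul_diagonal, ← diagonal_one, diagonal_add]
        congr 1
        funext i
        linear_combination hσμ i
      calc _ = Wᵀ * (P * (W * Wᵀ) * P) * W := by simp only [Matrix.mul_assoc]
        _ = Wᵀ * W + (Wᵀ * C * (V * Vᵀ)) * (Cᵀ * W) := by
            rw [hW', hVV', Matrix.mul_one, Matrix.mul_one, h1, Matrix.mul_add, Matrix.add_mul,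
              Matrix.mul_one]
            simp only [Matrix.mul_assoc]
        _ = Wᵀ * W + (Wᵀ * C * V) * (Wᵀ * C * V)ᵀ := by
            simp only [transpose_mul, transpose_transpose, Matrix.mul_assoc]
        _ = _ := by
            rw [hW, hCV', transpose_fromRows, fromRows_mul_fromCols, fromBlocks_multiply,
              ← fromBlocks_one, fromBlocks_add]
            simp only [diagonal_transpose, transpose_zero, Matrix.mul_zero, Matrix.zero_mul,
              add_zero, zero_add, Matrix.one_mul, hd]
  obtain ⟨k, hk, hkm⟩ := exists_mem_Hc (K₁ := Wᵀ) (K₂ := Vᵀ) (by rwa [transpose_transpose])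
    (by rwa [transpose_transpose]) (by
      rw [det_transpose, det_transpose, hVdef, det_mul, det_diagonal]
      linear_combination hεd)
  refine ⟨k, hk, a, ?_, hcosh⟩
  have hC'V : Vᵀ * C' * W = fromCols 0 (diagonal σ) := by
    have := congrArg transpose hCV'
    rw [transpose_fromRows, diagonal_transpose, transpose_zero] at this
    rw [← this, ← hC']
    simp only [transpose_mul, transpose_transpose, Matrix.mul_assoc]
  have hfin := Omega_mul_diagonal_mul_transpose (q := q) a
  simp only [hsinh, hcosh] at hfin
  calc _ = (Omega r q)ᵀ * (fromBlocks Wᵀ 0 0 Vᵀ * N * (fromBlocks Wᵀ 0 0 Vᵀ)ᵀ) * Omega r q := by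
        rw [hkm, hN]
        simp only [transpose_mul, transpose_transpose, Matrix.mul_assoc]
    _ = (Omega r q)ᵀ * (Omega r q * diagonal (fun i => Real.exp (2 * cartanVec q a i)) *
          (Omega r q)ᵀ) * Omega r q := by
        rw [hfin, hPC, fromBlocks_transpose, fromBlocks_multiply, fromBlocks_multiply]
        simp only [transpose_transpose, transpose_zero, Matrix.mul_zero, Matrix.zero_mul, add_zero,
          zero_add, hPW, hVmV, hCV', hC'V]
    _ = ((Omega r q)ᵀ * Omega r q) * diagonal (fun i => Real.exp (2 * cartanVec q a i)) *
          ((Omega r q)ᵀ * Omega r q) := by simp only [Matrix.mul_assoc]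
    _ = _ := by rw [transpose_Omega_mul_Omega, Matrix.one_mul, Matrix.mul_one]

/-! ### Distances along flats -/

section Flat

variable {r q : ℕ}

/-- The solvable coordinates of the Cartan element with parameters `a`. -/
def cartanCoord (q : ℕ) (a : Fin r → ℝ) : Coord r q → ℝ
  | Sum.inl p => if p.1.1 = p.1.2 then a p.1.1 else 0
  | Sum.inr _ => 0

/-- The element `diag (exp a, 1, exp (-a))` of the Cartan subgroup of `S`. -/
def cartanElt (q : ℕ) (a : Fin r → ℝ) : S r q := coordInv (cartanCoord q a)

theorem Lmat_cartanElt (a : Fin r → ℝ) :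
    Lmat (cartanElt q a) = diagonal fun i => Real.exp (cartanVec q a i) := by
  have hA : coordA (cartanCoord q a) = diagonal fun i => Real.exp (a i) := by
    ext i j
    simp only [coordA, cartanCoord, diagonal_apply]
    split_ifs with h1 h2 h2
    · rfl
    · rfl
    · exact absurd h2.le h1
    · rfl
  have hB : coordB (cartanCoord q a) = 0 := rfl
  have hZ : coordZ (cartanCoord q a) = 0 := by
    ext i j
    simp [coordZ, cartanCoord]
  have hI : (coordA (cartanCoord q a))⁻¹ = diagonal fun i => Real.exp (-a i) := by
    refine Matrix.inv_eq_right_inv ?_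
    rw [hA, diagonal_mul_diagonal, ← diagonal_one]
    congr 1
    funext i
    rw [← Real.exp_add, add_neg_cancel, Real.exp_zero]
  change coordMat _ = _
  rw [coordMat, hI, hA, hB, hZ]
  ext (i | i | i) (j | j | j) <;> simp [blk, cartanVec, diagonal_apply, Matrix.one_apply]

theorem matU_cartanElt (a : Fin r → ℝ) :
    matU (cartanElt q a : U r q) = diagonal fun i => Real.exp (cartanVec q a i) :=
  Lmat_cartanElt a

theorem calM_cartanElt (a : Fin r → ℝ) :
    calM (cartanElt q a) = diagonal fun i => Real.exp (2 * cartanVec q a i) := by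
  rw [calM, Lmat_cartanElt, diagonal_transpose, diagonal_mul_diagonal]
  congr 1
  funext i
  rw [← Real.exp_add, two_mul]

theorem sum_cartanVec_sq (a : Fin r → ℝ) : ∑ i, cartanVec q a i ^ 2 = 2 * ∑ i, a i ^ 2 := by
  simp [cartanVec, two_mul]

theorem cartanVec_flip (a : Fin r → ℝ) (i : Idx r q) :
    cartanVec q a (flip i) = -cartanVec q a i := by
  rcases i with i | i | i <;> simp [cartanVec, flip]

/-- The distance is at least the displacement of the diagonal part in the direction of `a`. -/
theorem le_geodesicEDist_one_cartanElt (a : Fin r → ℝ) :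
    ENNReal.ofReal √(∑ i, a i ^ 2) ≤
      geodesicEDist 𝓘(ℝ, Coord r q → ℝ) (metric r q) 1 (cartanElt q a) := by
  rcases (show (0 : ℝ) ≤ ∑ i, a i ^ 2 by positivity).eq_or_lt' with h0 | hpos
  · simp [h0]
  have hs := Real.sqrt_pos.mpr hpos
  have hsq := Real.sq_sqrt hpos.le
  -- the unit covector in the direction of `a`
  have hc : ∑ i, (cartanVec q a i / (2 * √(∑ i, a i ^ 2))) ^ 2 = 1 / 2 := by
    simp only [div_pow]
    rw [← Finset.sum_div, sum_cartanVec_sq, mul_pow, hsq]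
    field_simp
  have h := sum_mul_log_le_geodesicEDist (cartanElt q a)
    (c := fun i => cartanVec q a i / (2 * √(∑ i, a i ^ 2))) (by rw [hc]; norm_num)
  refine le_trans (le_of_eq ?_) h
  congr 1
  simp only [Lmat_cartanElt, diagonal_apply_eq, Real.log_exp]
  have : ∀ i, cartanVec q a i / (2 * √(∑ i, a i ^ 2)) * cartanVec q a i =
      cartanVec q a i ^ 2 / (2 * √(∑ i, a i ^ 2)) := fun i => by ring
  simp only [this]
  rw [← Finset.sum_div, sum_cartanVec_sq, eq_div_iff (by positivity)]
  linear_combination 2 * hsq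

/-- The one-parameter subgroup `t ↦ cartanElt q (t • a)` has constant speed. -/
theorem geodesicEDist_one_cartanElt_le (a : Fin r → ℝ) :
    geodesicEDist 𝓘(ℝ, Coord r q → ℝ) (metric r q) 1 (cartanElt q a) ≤
      ENNReal.ofReal √(∑ i, a i ^ 2) := by
  let _ := riemannianBundle r q
  rw [geodesicEDist_metric]
  let γ : ℝ → S r q := fun t => coordInv (t • cartanCoord q a)
  have hγ' : ∀ t, γ t = cartanElt q (t • a) := fun t => by
    refine congrArg coordInv (funext fun c => ?_)
    rcases c with ⟨⟨i, j⟩, h⟩ | c <;> simp [cartanCoord]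
  have hγ : ContMDiff 𝓘(ℝ, ℝ) 𝓘(ℝ, Coord r q → ℝ) ∞ γ :=
    (contMDiff_coordInv r q).comp (contDiff_id.smul contDiff_const).contMDiff
  have hd : ∀ t, MDifferentiableAt 𝓘(ℝ, ℝ) 𝓘(ℝ, Coord r q → ℝ) γ t :=
    hγ.mdifferentiable (by simp)
  refine (riemannianEDist_le_pathELength (hγ.of_le (by simp)).contMDiffOn (a := 0) (b := 1)
    ?_ ?_ zero_le_one).trans ?_
  · refine Lmat_injective ?_
    rw [hγ', Lmat_cartanElt, show Lmat (1 : S r q) = 1 from rfl, ← diagonal_one]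
    congr 1
    funext i
    rcases i with i | i | i <;> simp [cartanVec]
  · rw [hγ', one_smul]
  have hspeed : ∀ t, ‖mfderiv 𝓘(ℝ, ℝ) 𝓘(ℝ, Coord r q → ℝ) γ t (1 : ℝ)‖ₑ =
      ENNReal.ofReal √(∑ i, a i ^ 2) := by
    intro t
    rw [enorm_tangent, metricForm_self]
    have hdL : dL (γ t) (mfderiv 𝓘(ℝ, ℝ) 𝓘(ℝ, Coord r q → ℝ) γ t (1 : ℝ)) =
        Lmat (γ t) * diagonal (cartanVec q a) := by
      ext i j
      refine (hasDerivAt_Lmat (hd t) i j).unique ?_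
      simp only [hγ', Lmat_cartanElt, mul_diagonal, diagonal_apply]
      split_ifs with h
      · subst h
        have hv : ∀ t, cartanVec q (t • a) i = t * cartanVec q a i := fun t => by
          rcases i with i | i | i <;> simp [cartanVec]
        simp only [hv]
        simpa using ((hasDerivAt_id t).mul_const (cartanVec q a i)).exp
      · simpa using hasDerivAt_const t (0 : ℝ)
    have hV : vielbein (γ t) (mfderiv 𝓘(ℝ, ℝ) 𝓘(ℝ, Coord r q → ℝ) γ t (1 : ℝ)) =
        diagonal (cartanVec q a) := by
      rw [vielbein, theta, hdL, ← Matrix.mul_assoc, inv_mul_Lmat, Matrix.one_mul,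
        diagonal_transpose, ← two_smul ℝ, smul_smul]
      norm_num
    rw [hV]
    have : ∀ i, ∑ j, (diagonal (cartanVec q a) i j) ^ 2 = cartanVec q a i ^ 2 := fun i => by
      rw [Finset.sum_eq_single i] <;> simp +contextual [eq_comm]
    simp only [this]
    rw [sum_cartanVec_sq]
    congr 2
    ring
  rw [pathELength_eq_lintegral_mfderiv_Icc]
  refine le_of_eq ((MeasureTheory.lintegral_congr hspeed).trans ?_)
  simp

theorem geodesicEDist_cartanElt (a b : Fin r → ℝ) :
    geodesicEDist 𝓘(ℝ, Coord r q → ℝ) (metric r q) (cartanElt q a) (cartanElt q b) =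
      ENNReal.ofReal √(∑ i, (b i - a i) ^ 2) := by
  have h := (le_antisymm (geodesicEDist_one_cartanElt_le (q := q) (b - a))
    (le_geodesicEDist_one_cartanElt (q := q) (b - a)))
  simp only [Pi.sub_apply] at h
  rw [← h]
  have hc : ∀ c : Fin r → ℝ, matU (cartanElt q (-a) : U r q) * calM (cartanElt q c) *
      (matU (cartanElt q (-a) : U r q))ᵀ = calM (cartanElt q (c - a)) := fun c => by
    rw [matU_cartanElt, calM_cartanElt, calM_cartanElt, diagonal_transpose, diagonal_mul_diagonal,
      diagonal_mul_diagonal]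
    congr 1
    funext i
    rw [← Real.exp_add, ← Real.exp_add]
    congr 1
    rcases i with i | i | i <;> simp [cartanVec] <;> ring
  refine (geodesicEDist_action (cartanElt q (-a) : U r q) ?_ (hc b).symm).symm
  rw [hc, sub_self, calM_cartanElt]
  change (1 : Matrix (Idx r q) (Idx r q) ℝ) * 1ᵀ = _
  rw [transpose_one, Matrix.one_mul, ← diagonal_one]
  congr 1
  funext i
  rcases i with i | i | i <;> simp [cartanVec]

theorem geodesicEDist_of_conj (A : U r q) (a b : Fin r → ℝ) {u v : S r q}
    (hu : calM u = matU A * calM (cartanElt q a) * (matU A)ᵀ)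
    (hv : calM v = matU A * calM (cartanElt q b) * (matU A)ᵀ) :
    geodesicEDist 𝓘(ℝ, Coord r q → ℝ) (metric r q) u v =
      ENNReal.ofReal √(∑ i, (b i - a i) ^ 2) := by
  rw [geodesicEDist_action A hu hv, geodesicEDist_cartanElt]

/-- Any two points lie in a common flat, the image of the Cartan subgroup under an element of `U`. -/
theorem exists_flat (hr : 1 ≤ r) (u v : S r q) :
    ∃ (A : U r q) (a : Fin r → ℝ), calM u = matU A * (matU A)ᵀ ∧
      calM v = matU A * calM (cartanElt q a) * (matU A)ᵀ ∧
      ∀ i, Real.cosh (2 * a i) = (mBlock_posDef (u⁻¹ * v)).isHermitian.eigenvalues i := by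
  obtain ⟨k, hk, a, h1, h2⟩ := exists_cartan hr (u⁻¹ * v)
  have hk1 : (matU k)ᵀ * matU k = 1 := hk
  have hk2 : matU k⁻¹ = (matU k)ᵀ := by
    rw [matU_inv_eq]; exact Matrix.inv_eq_left_inv hk1
  refine ⟨u * k⁻¹, a, ?_, ?_, h2⟩
  · rw [matU_mul, transpose_mul, hk2, transpose_transpose, Matrix.mul_assoc,
      ← Matrix.mul_assoc (matU k)ᵀ, hk1, Matrix.one_mul]
    rfl
  · rw [calM_cartanElt, ← h1, matU_mul, transpose_mul, hk2, transpose_transpose]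
    have h3 : calM v = Lmat u * calM (u⁻¹ * v) * (Lmat u)ᵀ := by
      have h4 : Lmat v = Lmat u * Lmat (u⁻¹ * v) := by
        change _ = Lmat (u * (u⁻¹ * v))
        rw [mul_inv_cancel_left]
      rw [calM, h4, calM, transpose_mul]
      simp only [Matrix.mul_assoc]
    rw [h3]
    calc _ = Lmat u * ((matU k)ᵀ * matU k) * calM (u⁻¹ * v) * ((matU k)ᵀ * matU k) *
          (Lmat u)ᵀ := by rw [hk1, Matrix.mul_one, Matrix.mul_one]
      _ = _ := by simp only [Matrix.mul_assoc]; rfl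

/-- `N²` as a function of the Cartan parameters. Their signs do not matter, because
`arcosh (cosh x) = |x|`. -/
theorem N2_eq_sum {w : S r q} {a : Fin r → ℝ}
    (h : ∀ i, Real.cosh (2 * a i) = (mBlock_posDef w).isHermitian.eigenvalues i) :
    N2 w = ∑ i, a i ^ 2 := by
  have hm := (mBlock_posDef w).isHermitian
  rw [N2, hm.cfc_eq, IsHermitian.cfc, Unitary.conjStarAlgAut_apply, trace_mul_comm,
    ← Matrix.mul_assoc, Unitary.coe_star_mul_self, Matrix.one_mul, trace_diagonal, Finset.mul_sum]
  refine Finset.sum_congr rfl fun i _ => ?_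
  simp only [Function.comp_apply, RCLike.ofReal_real_eq_id, id]
  rw [← h, ← Real.cosh_abs, Real.arcosh_cosh (abs_nonneg _), sq_abs]
  ring

theorem geodesicEDist_sq (hr : 1 ≤ r) (u v : S r q) :
    geodesicEDist 𝓘(ℝ, Coord r q → ℝ) (metric r q) u v ^ 2 = ENNReal.ofReal (N2 (u⁻¹ * v)) := by
  obtain ⟨A, a, h1, h2, h3⟩ := exists_flat hr u v
  have h0 : calM (cartanElt q (0 : Fin r → ℝ)) = 1 := by
    rw [calM_cartanElt, ← diagonal_one]
    congr 1
    funext i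
    rcases i with i | i | i <;> simp [cartanVec]
  rw [geodesicEDist_of_conj A 0 a (by rw [h0, Matrix.mul_one, h1]) h2, N2_eq_sum h3,
    ← ENNReal.ofReal_pow (Real.sqrt_nonneg _), Real.sq_sqrt (by positivity)]
  simp

theorem N2_nonneg (hr : 1 ≤ r) (w : S r q) : 0 ≤ N2 w := by
  obtain ⟨k, -, a, -, h⟩ := exists_cartan hr w
  rw [N2_eq_sum h]
  positivity

theorem N2_eq_zero_iff (hr : 1 ≤ r) (w : S r q) : N2 w = 0 ↔ w = 1 := by
  constructor
  · intro h0
    obtain ⟨k, hk, a, h1, h2⟩ := exists_cartan hr w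
    rw [N2_eq_sum h2, Finset.sum_eq_zero_iff_of_nonneg fun i _ => sq_nonneg _] at h0
    have ha : a = 0 := funext fun i => pow_eq_zero_iff two_ne_zero |>.mp (h0 i (Finset.mem_univ i))
    have hd : (diagonal fun i => Real.exp (2 * cartanVec q a i)) = 1 := by
      rw [ha, ← diagonal_one]
      congr 1
      funext i
      rcases i with i | i | i <;> simp [cartanVec]
    have hk1 : (matU k)ᵀ * matU k = 1 := hk
    refine calM_injective ?_
    change _ = (1 : Matrix (Idx r q) (Idx r q) ℝ) * 1ᵀ
    rw [transpose_one, Matrix.one_mul]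
    calc calM w = ((matU k)ᵀ * matU k) * calM w * ((matU k)ᵀ * matU k) := by
          rw [hk1, Matrix.one_mul, Matrix.mul_one]
      _ = (matU k)ᵀ * (matU k * calM w * (matU k)ᵀ) * matU k := by simp only [Matrix.mul_assoc]
      _ = 1 := by rw [h1, hd, Matrix.mul_one, hk1]
  · rintro rfl
    let _ := riemannianBundle r q
    have h := geodesicEDist_sq hr (1 : S r q) 1
    rw [inv_one, one_mul, geodesicEDist_metric, riemannianEDist_self] at h
    have : N2 (1 : S r q) ≤ 0 := by
      rw [← ENNReal.ofReal_eq_zero, ← h]; simp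
    exact le_antisymm this (N2_nonneg hr 1)

theorem isNormFunction_N2 (hr : 1 ≤ r) :
    IsNormFunction 𝓘(ℝ, Coord r q → ℝ) (metric r q) (N2 (r := r) (q := q)) :=
  ⟨N2_nonneg hr, N2_eq_zero_iff hr, geodesicEDist_sq hr⟩

theorem posSemidef_mBlock_sub_one (hr : 1 ≤ r) (w : S r q) : (mBlock w - 1).PosSemidef := by
  obtain ⟨k, -, a, -, h⟩ := exists_cartan hr w
  obtain ⟨V, hV, hm⟩ := exists_orthogonal_diagonalization (mBlock_posDef w).isHermitian
  have hV' := mul_eq_one_comm.mp hV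
  have e : mBlock w - 1 =
      V * diagonal (fun i => (mBlock_posDef w).isHermitian.eigenvalues i - 1) * Vᴴ := by
    rw [conjTranspose_eq_transpose_of_trivial]
    conv_lhs => rw [hm]
    rw [← diagonal_sub, diagonal_one, Matrix.mul_sub, Matrix.sub_mul, Matrix.mul_one, hV']
  rw [e]
  refine PosSemidef.mul_mul_conjTranspose_same (PosSemidef.diagonal fun i => ?_) V
  rw [Pi.zero_apply, ← h]
  exact sub_nonneg.mpr (Real.one_le_cosh _)

/-- Points of `S` are joined by geodesic lines: if `A` carries the flat of the Cartan subgroup to a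
flat through both points, the line consists of the cosets `A diag (exp ta, 1, exp (-ta)) H`, and its
generator is `Q = A diag (2a, 0, -2a) A⁻¹`. -/
theorem exists_geodesic (hr : 1 ≤ r) (u v : S r q) :
    ∃ (Q : Matrix (Idx r q) (Idx r q) ℝ) (γ : ℝ → S r q),
      Qᵀ * etaT r q + etaT r q * Q = 0 ∧ γ 0 = u ∧ γ 1 = v ∧
      (∀ t, calM (γ t) = calM u * NormedSpace.exp (t • Qᵀ)) ∧
      ∀ t t' : ℝ, geodesicEDist 𝓘(ℝ, Coord r q → ℝ) (metric r q) (γ t) (γ t') =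
        ENNReal.ofReal |t - t'| * geodesicEDist 𝓘(ℝ, Coord r q → ℝ) (metric r q) u v := by
  obtain ⟨A, a, h1, h2, -⟩ := exists_flat hr u v
  have hA : matU A * (matU A)⁻¹ = 1 := by rw [← matU_inv_eq, ← matU_mul, mul_inv_cancel, matU_one]
  have hA' : (matU A)⁻¹ * matU A = 1 := mul_eq_one_comm.mp hA
  choose γ hγ using fun t : ℝ => exists_calM_eq (A * (cartanElt q (t • a) : U r q))
  have hγ' : ∀ t, calM (γ t) = matU A * calM (cartanElt q (t • a)) * (matU A)ᵀ := fun t => by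
    rw [hγ, matU_mul, transpose_mul]
    simp only [calM, Matrix.mul_assoc]
    rfl
  have hv : ∀ (t : ℝ) (i : Idx r q), cartanVec q (t • a) i = t * cartanVec q a i := fun t i => by
    rcases i with i | i | i <;> simp [cartanVec]
  have hγ0 : γ 0 = u := calM_injective <| by
    rw [hγ', h1, calM_cartanElt]
    simp only [hv, zero_mul, mul_zero, Real.exp_zero, diagonal_one, Matrix.mul_one]
  have hγ1 : γ 1 = v := calM_injective <| by rw [hγ', h2, one_smul]
  obtain ⟨D, hD⟩ : ∃ D : Matrix (Idx r q) (Idx r q) ℝ,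
    D = diagonal fun i => 2 * cartanVec q a i := ⟨_, rfl⟩
  have hQ : (matU A * D * (matU A)⁻¹)ᵀ = ((matU A)ᵀ)⁻¹ * D * (matU A)ᵀ := by
    rw [transpose_mul, transpose_mul, transpose_nonsing_inv, hD, diagonal_transpose,
      Matrix.mul_assoc]
  have hAT : (matU A)ᵀ * ((matU A)ᵀ)⁻¹ = 1 := by
    rw [← transpose_nonsing_inv, ← transpose_mul, hA', transpose_one]
  have hAT' : ((matU A)ᵀ)⁻¹ * (matU A)ᵀ = 1 := mul_eq_one_comm.mp hAT
  refine ⟨matU A * D * (matU A)⁻¹, γ, ?_, hγ0, hγ1, fun t => ?_, fun t t' => ?_⟩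
  · have hη := matU_transpose_mul_etaT_mul A
    have hη1 : (matU A)ᵀ * etaT r q = etaT r q * (matU A)⁻¹ := by
      rw [← Matrix.mul_one ((matU A)ᵀ * etaT r q), ← hA, ← Matrix.mul_assoc, hη]
    have hη2 : etaT r q * matU A = ((matU A)ᵀ)⁻¹ * etaT r q := by
      rw [← Matrix.one_mul (etaT r q * matU A), ← hAT', Matrix.mul_assoc, ← Matrix.mul_assoc (matU A)ᵀ,
        hη]
    have hDη : D * etaT r q + etaT r q * D = 0 := by
      ext i j
      rw [Matrix.add_apply, mul_etaT, etaT_mul, hD, diagonal_apply, diagonal_apply,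
        cartanVec_flip]
      by_cases h : i = flip j
      · subst h
        simp [flip_flip, cartanVec_flip]
      · have h' : flip i ≠ j := fun e => h (by rw [← e, flip_flip])
        simp [h, h']
    calc _ = ((matU A)ᵀ)⁻¹ * D * ((matU A)ᵀ * etaT r q) +
          (etaT r q * matU A) * D * (matU A)⁻¹ := by
          rw [hQ]; simp only [Matrix.mul_assoc]
      _ = ((matU A)ᵀ)⁻¹ * (D * etaT r q + etaT r q * D) * (matU A)⁻¹ := by
          rw [hη1, hη2, Matrix.mul_add, Matrix.add_mul]
          simp only [Matrix.mul_assoc]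
      _ = 0 := by rw [hDη, Matrix.mul_zero, Matrix.zero_mul]
  · have hu : IsUnit (matU A)ᵀ := IsUnit.of_mul_eq_one _ hAT
    have hexp : NormedSpace.exp (t • D) = calM (cartanElt q (t • a)) := by
      rw [calM_cartanElt, hD, ← diagonal_smul, Matrix.exp_diagonal]
      congr 1
      funext i
      rw [Pi.coe_exp, Real.exp_eq_exp_ℝ, hv, Pi.smul_apply, smul_eq_mul]
      congr 1
      ring
    rw [hγ', hQ, h1, ← Matrix.smul_mul, ← Matrix.mul_smul, Matrix.exp_conj' _ _ hu, hexp]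
    calc _ = matU A * 1 * calM (cartanElt q (t • a)) * (matU A)ᵀ := by rw [Matrix.mul_one]
      _ = _ := by rw [← hAT]; simp only [Matrix.mul_assoc]
  · have h3 : ∀ t t' : ℝ, geodesicEDist 𝓘(ℝ, Coord r q → ℝ) (metric r q) (γ t) (γ t') =
        ENNReal.ofReal (|t - t'| * √(∑ i, a i ^ 2)) := fun t t' => by
      rw [geodesicEDist_of_conj A _ _ (hγ' t) (hγ' t'), ← Real.sqrt_sq_eq_abs,
        ← Real.sqrt_mul (sq_nonneg _), Finset.mul_sum]
      congr 2
      refine Finset.sum_congr rfl fun i _ => ?_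
      simp only [Pi.smul_apply, smul_eq_mul]
      ring
    have h4 := h3 0 1
    rw [hγ0, hγ1] at h4
    rw [h3, h4, zero_sub, abs_neg, abs_one, one_mul, ENNReal.ofReal_mul (abs_nonneg _)]

end Flat

/-! ### The homeomorphism with `U / H` -/

section Topology

variable {r q : ℕ}

theorem isClosedEmbedding_matU : Topology.IsClosedEmbedding (matU (r := r) (q := q)) := by
  refine ⟨⟨Topology.IsInducing.subtypeVal.comp Topology.IsInducing.subtypeVal, matU_injective⟩, ?_⟩
  have h : Set.range (matU (r := r) (q := q)) = {M | M.det = 1 ∧ Mᵀ * etaT r q * M = etaT r q} := by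
    ext M
    exact ⟨fun ⟨A, hA⟩ => hA ▸ ⟨matU_det A, matU_transpose_mul_etaT_mul A⟩,
      fun ⟨h1, h2⟩ => ⟨⟨⟨M, h1⟩, h2⟩, rfl⟩⟩
  rw [h]
  exact (isClosed_eq (by fun_prop) continuous_const).inter
    (isClosed_eq (by fun_prop) continuous_const)

theorem isCompact_orthogonal (n : Type*) [Fintype n] [DecidableEq n] :
    IsCompact {M : Matrix n n ℝ | Mᵀ * M = 1} := by
  have hc : IsCompact (Set.univ.pi fun _ : n => Set.univ.pi fun _ : n => Set.Icc (-1 : ℝ) 1) :=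
    isCompact_univ_pi fun _ => isCompact_univ_pi fun _ => isCompact_Icc
  refine hc.of_isClosed_subset (isClosed_eq (by fun_prop) continuous_const) ?_
  rintro (M : Matrix n n ℝ) hM i _ j _
  have h := congrFun (congrFun (show Mᵀ * M = 1 from hM) j) j
  rw [Matrix.mul_apply, one_apply_eq] at h
  have h1 : Mᵀ j i * M i j ≤ ∑ k, Mᵀ j k * M k j :=
    Finset.single_le_sum (f := fun k => Mᵀ j k * M k j) (fun k _ => mul_self_nonneg (M k j))
      (Finset.mem_univ i)
  rw [h, transpose_apply] at h1
  rw [Set.mem_Icc]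
  constructor <;> nlinarith

theorem isCompact_Hc : IsCompact (Hc r q : Set (U r q)) :=
  isClosedEmbedding_matU.isCompact_preimage (isCompact_orthogonal (Idx r q))

theorem isClosed_S : IsClosed (S r q : Set (U r q)) := by
  have hc : ∀ i j, Continuous fun A : U r q => matU A i j := fun i j =>
    (continuous_apply_apply i j).comp isClosedEmbedding_matU.continuous
  -- diagonal entries of triangular elements do not vanish, so nonnegativity is enough
  have h : (S r q : Set (U r q)) =
      {A | ∀ i j, pos j < pos i → matU A i j = 0} ∩ {A | ∀ i, 0 ≤ matU A i i} := by
    ext A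
    refine ⟨fun hA => ⟨fun i j h => hA.1 h, fun i => (hA.2 i).le⟩, fun ⟨h1, h2⟩ => ?_⟩
    have hT : BlockTriangular (matU A) pos := fun i j h => h1 i j h
    have h3 : matU A * matU A⁻¹ = 1 := by rw [← matU_mul, mul_inv_cancel, matU_one]
    have hT' : BlockTriangular (matU A⁻¹) pos := by
      rw [matU_inv_eq]
      have : Invertible (matU A) := invertibleOfRightInverse _ _ h3
      exact blockTriangular_inv_of_blockTriangular hT
    refine ⟨hT, fun i => (h2 i).lt_of_ne' fun h0 => ?_⟩
    have h4 := mul_apply_diag hT hT' i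
    rw [h3, one_apply_eq, h0, zero_mul] at h4
    exact one_ne_zero h4
  rw [h]
  simp only [Set.ofPred_forall]
  exact (isClosed_iInter fun i => isClosed_iInter fun j => isClosed_iInter fun _ =>
    isClosed_eq (hc i j) continuous_const).inter
    (isClosed_iInter fun i => isClosed_le continuous_const (hc i i))

/-- Injectivity and surjectivity are the uniqueness and the existence of the Iwasawa decomposition;
the map is closed because `S` is closed in `U` and `H` is compact. -/
theorem isHomeomorph_quotient :
    IsHomeomorph (fun s : S r q => ((s : U r q) : U r q ⧸ Hc r q)) := by
  rw [isHomeomorph_iff_continuous_isClosedMap_bijective]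
  refine ⟨QuotientGroup.continuous_mk.comp continuous_subtype_val,
    (QuotientGroup.isClosedMap_coe isCompact_Hc).comp
      isClosed_S.isClosedEmbedding_subtypeVal.isClosedMap,
    fun s t h => calM_injective ((mk_eq_mk_iff _ _).mp h), fun x => ?_⟩
  obtain ⟨A, rfl⟩ := QuotientGroup.mk_surjective x
  obtain ⟨s, hs⟩ := exists_calM_eq A
  exact ⟨s, (mk_eq_mk_iff _ _).mpr hs⟩

end Topology

/-! ### Solvability -/

section Solvable

variable {r q : ℕ}

/-- Matrices that vanish below the `k`-th diagonal above the main one. -/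
def IsBand (k : ℕ) (A : Matrix (Idx r q) (Idx r q) ℝ) : Prop :=
  ∀ i j, pos j < pos i + k → A i j = 0

theorem IsBand.mul {k l : ℕ} {A B : Matrix (Idx r q) (Idx r q) ℝ} (hA : IsBand k A)
    (hB : IsBand l B) : IsBand (k + l) (A * B) := fun i j h => by
  rw [Matrix.mul_apply]
  refine Finset.sum_eq_zero fun m _ => ?_
  by_cases h1 : pos m < pos i + k
  · rw [hA i m h1, zero_mul]
  · rw [hB m j (by omega), mul_zero]

theorem IsBand.add {k : ℕ} {A B : Matrix (Idx r q) (Idx r q) ℝ} (hA : IsBand k A)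
    (hB : IsBand k B) : IsBand k (A + B) := fun i j h => by
  rw [Matrix.add_apply, hA i j h, hB i j h, add_zero]

theorem IsBand.neg {k : ℕ} {A : Matrix (Idx r q) (Idx r q) ℝ} (hA : IsBand k A) :
    IsBand k (-A) := fun i j h => by rw [Matrix.neg_apply, hA i j h, neg_zero]

theorem IsBand.mono {k l : ℕ} (h : l ≤ k) {A : Matrix (Idx r q) (Idx r q) ℝ} (hA : IsBand k A) :
    IsBand l A := fun i j hij => hA i j (by omega)

theorem isBand_Lmat (s : S r q) : IsBand 0 (Lmat s) := fun _ _ h => s.2.1 h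

theorem Lmat_mul (s t : S r q) : Lmat (s * t) = Lmat s * Lmat t := rfl

/-- The subgroup of the elements whose difference to the identity vanishes below the `k`-th upper
diagonal. -/
def bandSubgroup (r q k : ℕ) : Subgroup (S r q) where
  carrier := {s | IsBand k (Lmat s - 1)}
  one_mem' := fun i j _ => by
    change (1 - 1 : Matrix (Idx r q) (Idx r q) ℝ) i j = 0
    rw [sub_self, Matrix.zero_apply]
  mul_mem' := by
    intro s t hs ht
    have e : Lmat (s * t) - 1 = Lmat s * (Lmat t - 1) + (Lmat s - 1) := by
      rw [Lmat_mul, Matrix.mul_sub, Matrix.mul_one]; abel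
    change IsBand k (Lmat (s * t) - 1)
    rw [e]
    exact (((isBand_Lmat s).mul ht).mono (by omega)).add hs
  inv_mem' := by
    intro s hs
    have e : Lmat s⁻¹ - 1 = -(Lmat s⁻¹ * (Lmat s - 1)) := by
      rw [Matrix.mul_sub, Matrix.mul_one, ← Lmat_mul, inv_mul_cancel,
        show Lmat (1 : S r q) = 1 from rfl]
      abel
    change IsBand k (Lmat s⁻¹ - 1)
    rw [e]
    exact (((isBand_Lmat s⁻¹).mul hs).mono (by omega)).neg

theorem isBand_commutator {k : ℕ} {s t : S r q}
    (h : IsBand k (Lmat s * Lmat t - Lmat t * Lmat s)) :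
    IsBand k (Lmat (s * t * s⁻¹ * t⁻¹) - 1) := by
  have e : Lmat (s * t * s⁻¹ * t⁻¹) - 1 = (Lmat s * Lmat t - Lmat t * Lmat s) * Lmat (s⁻¹ * t⁻¹) := by
    rw [Matrix.sub_mul, ← Lmat_mul, ← Lmat_mul, ← Lmat_mul, ← Lmat_mul, ← mul_assoc (s * t),
      show t * s * (s⁻¹ * t⁻¹) = 1 by group]
    rfl
  rw [e]
  exact h.mul (isBand_Lmat _)

/-- The first commutator subgroup loses the diagonal; a commutator of elements of the `k`-th band
subgroup, `1 ≤ k`, lies in the `2k`-th one, as `st - ts = (s - 1)(t - 1) - (t - 1)(s - 1)`. -/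
theorem derivedSeries_le_bandSubgroup (k : ℕ) :
    derivedSeries (S r q) (k + 1) ≤ bandSubgroup r q (k + 1) := by
  induction k with
  | zero =>
    rw [derivedSeries_succ, Subgroup.commutator_le]
    intro s _ t _
    refine isBand_commutator fun i j h => ?_
    rcases (show pos j ≤ pos i by omega).lt_or_eq with hij | hij
    · rw [Matrix.sub_apply, ← Lmat_mul, ← Lmat_mul, isBand_Lmat _ i j hij, isBand_Lmat _ i j hij,
        sub_zero]
    · obtain rfl := pos_injective hij
      exact sub_eq_zero.mpr ((mul_apply_diag s.2.1 t.2.1 j).trans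
        ((mul_comm _ _).trans (mul_apply_diag t.2.1 s.2.1 j).symm))
  | succ k ih =>
    rw [derivedSeries_succ, Subgroup.commutator_le]
    intro s hs t ht
    have hs := ih hs
    have ht := ih ht
    have e : Lmat s * Lmat t - Lmat t * Lmat s =
        (Lmat s - 1) * (Lmat t - 1) + -((Lmat t - 1) * (Lmat s - 1)) := by
      simp only [Matrix.mul_sub, Matrix.sub_mul, Matrix.one_mul, Matrix.mul_one]; abel
    refine isBand_commutator ?_
    rw [e]
    exact ((hs.mul ht).mono (by omega)).add ((ht.mul hs).mono (by omega)).neg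

theorem isSolvable_S : Group.IsSolvable (S r q) := by
  refine ⟨r + q + r + 1, ?_⟩
  rw [eq_bot_iff]
  intro s hs
  have h := derivedSeries_le_bandSubgroup _ hs
  refine Subgroup.mem_bot.mpr (Lmat_injective ?_)
  change Lmat s = 1
  rw [← sub_eq_zero]
  ext i j
  refine h i j ?_
  have : pos j < r + q + r := by
    rcases j with j | j | j <;> simp only [pos, Fin.val_rev] <;> have := j.isLt <;> omega
  omega

end Solvable

end SOrrq

end

theorem mainTheorem1 (r q : ℕ) (hr : 1 ≤ r) :
    IsHomeomorph (fun s : SOrrq.S r q => ((s : SOrrq.U r q) : SOrrq.U r q ⧸ SOrrq.Hc r q)) ∧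
    (∀ w : SOrrq.S r q, (SOrrq.mBlock w - 1).PosSemidef) ∧
    (∃ g : Bundle.ContMDiffRiemannianMetric 𝓘(ℝ, SOrrq.Coord r q → ℝ) ∞ (SOrrq.Coord r q → ℝ)
        (fun s : SOrrq.S r q => TangentSpace 𝓘(ℝ, SOrrq.Coord r q → ℝ) s),
      (∀ (s : SOrrq.S r q) (X Y : TangentSpace 𝓘(ℝ, SOrrq.Coord r q → ℝ) s),
        g.inner s X Y = SOrrq.metricForm s X Y) ∧
      (∀ (a : SOrrq.U r q) (u v u' v' : SOrrq.S r q),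
        ((u' : SOrrq.U r q) : SOrrq.U r q ⧸ SOrrq.Hc r q) = ((a * u : SOrrq.U r q)) →
        ((v' : SOrrq.U r q) : SOrrq.U r q ⧸ SOrrq.Hc r q) = ((a * v : SOrrq.U r q)) →
        geodesicEDist 𝓘(ℝ, SOrrq.Coord r q → ℝ) g u' v' =
          geodesicEDist 𝓘(ℝ, SOrrq.Coord r q → ℝ) g u v) ∧
      (∀ u v : SOrrq.S r q,
        ∃ (Q : Matrix (SOrrq.Idx r q) (SOrrq.Idx r q) ℝ) (γ : ℝ → SOrrq.S r q),
          Qᵀ * SOrrq.etaT r q + SOrrq.etaT r q * Q = 0 ∧ γ 0 = u ∧ γ 1 = v ∧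
          (∀ t, SOrrq.calM (γ t) = SOrrq.calM u * NormedSpace.exp (t • Qᵀ)) ∧
          ∀ t t' : ℝ, geodesicEDist 𝓘(ℝ, SOrrq.Coord r q → ℝ) g (γ t) (γ t') =
            ENNReal.ofReal |t - t'| * geodesicEDist 𝓘(ℝ, SOrrq.Coord r q → ℝ) g u v) ∧
      IsNormFunction 𝓘(ℝ, SOrrq.Coord r q → ℝ) g (SOrrq.N2 (r := r) (q := q))) ∧
    IsNormedSolvableLieGroup 𝓘(ℝ, SOrrq.Coord r q → ℝ) (SOrrq.S r q) := by
  have hact : ∀ (a : SOrrq.U r q) (u u' : SOrrq.S r q),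
      ((u' : SOrrq.U r q) : SOrrq.U r q ⧸ SOrrq.Hc r q) = ((a * u : SOrrq.U r q)) →
      SOrrq.calM u' = SOrrq.matU a * SOrrq.calM u * (SOrrq.matU a)ᵀ := fun a u u' h => by
    refine ((SOrrq.mk_eq_mk_iff _ _).mp h).trans ?_
    rw [SOrrq.matU_mul, transpose_mul]
    simp only [SOrrq.calM, SOrrq.Lmat, Matrix.mul_assoc]
  exact ⟨SOrrq.isHomeomorph_quotient, SOrrq.posSemidef_mBlock_sub_one hr,
    ⟨SOrrq.metric r q, SOrrq.metric_inner,
      fun a u v u' v' hu hv => SOrrq.geodesicEDist_action a (hact a u u' hu) (hact a v v' hv),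
      SOrrq.exists_geodesic hr, SOrrq.isNormFunction_N2 hr⟩,
    SOrrq.isSolvable_S, SOrrq.metric r q, SOrrq.N2, SOrrq.isNormFunction_N2 hr⟩
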